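/- Let $(M,g)$ be a smooth Riemannian manifold of dimension $d$ (without boundary) with Levi-Civita connection $\nabla$ and Riemannian volume measure $\mu_g$, and let $V$ be a smooth vector field on $M$. Assume that $V$ is \emph{cylindrical} with compact cross-section: there is a compact codimension one submanifold $Y \subset M$ (without boundary), transverse to $V$, such that the flow of $V$ defines a diffeomorphism $\mathbb{R} \times Y \simeq M$. Assume moreover that $g$ is $V$-linear of slope $1$, i.e. $\mathcal{L}_V g = g$, and that the endomorphism $\nabla V : TM \to TM$ is self-adjoint. Let $U(M;V)$ be the set of smooth positive functions $F : M \to \mathbb{R}$ with $VF = F$, and for $F \in U(M;V)$ put \[ S(F) := \int_{\{F \le 1\}} \Delta F \, d\mu_g , \qquad \Delta F = \operatorname{tr}(\nabla^2 F). \] Let $G, H \in U(M;V)$ have positive semi-definite Hessians $\nabla^2 G$ and $\nabla^2 H$, and suppose that $G \le H \le L \cdot G$ for a constant $L \ge 1$. Then $\Delta G$ and $\Delta H$ are integrable over $\{G \le 1\}$ and $\{H \le 1\}$ respectively, so that $S(G)$ and $S(H)$ are finite, and \[ S(H) \le \exp\left(\tfrac{1}{2} L d^2\right) \cdot S(G).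 \] -/

import Mathlib

open scoped ContDiff Manifold

noncomputable section

namespace LaplacianFunctional

open Bundle Manifold MeasureTheory VectorField

variable {E : Type*} [NormedAddCommGroup E] [NormedSpace ℝ E] [FiniteDimensional ℝ E]
  {H : Type*} [TopologicalSpace H] {I : ModelWithCorners ℝ E H}
  {M : Type*} [TopologicalSpace M] [ChartedSpace H M] [IsManifold I ∞ M]

/-- A smooth Riemannian metric on `M`. -/
abbrev SmoothMetric {E : Type*} [NormedAddCommGroup E] [NormedSpace ℝ E]
    {H : Type*} [TopologicalSpace H] (I : ModelWithCorners ℝ E H)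
    (M : Type*) [TopologicalSpace M] [ChartedSpace H M] [IsManifold I ∞ M] :=
  ContMDiffRiemannianMetric I ∞ E (TangentSpace I : M → Type _)

variable (g : SmoothMetric I M)

/-- The function `p ↦ g_p(X_p, Y_p)`. -/
def pairing (X Y : Π x : M, TangentSpace I x) : M → ℝ := fun p ↦ g.inner p (X p) (Y p)

lemma pairing_comm (X Y : Π x : M, TangentSpace I x) : pairing g X Y = pairing g Y X :=
  funext fun p ↦ g.symm p _ _

lemma mdifferentiableAt_pairing {X Y : Π x : M, TangentSpace I x} {p : M}
    (hX : MDiffAt (T% X) p) (hY : MDiffAt (T% Y) p) : MDiffAt (pairing g X Y) p := by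
  have h1 := g.contMDiff.mdifferentiableAt (x := p) (by simp)
  have : MDifferentiableAt I (I.prod 𝓘(ℝ))
      (fun m ↦ TotalSpace.mk' ℝ (E := Bundle.Trivial M ℝ) m (g.inner m (X m) (Y m))) p := by
    apply MDifferentiableAt.clm_bundle_apply₂ (F₁ := E) (F₂ := E)
    · exact h1
    · exact hX
    · exact hY
  simp only [mdifferentiableAt_totalSpace] at this
  exact this.2

/-- The isomorphism `T_pM ≃ T_p^*M`, `v ↦ g_p(v, ·)`. -/
def flat (p : M) : TangentSpace I p ≃ₗ[ℝ] (TangentSpace I p →L[ℝ] ℝ) :=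
  haveI : FiniteDimensional ℝ (TangentSpace I p) := inferInstanceAs (FiniteDimensional ℝ E)
  haveI : FiniteDimensional ℝ (TangentSpace I p →L[ℝ] ℝ) :=
    inferInstanceAs (FiniteDimensional ℝ (E →L[ℝ] ℝ))
  LinearMap.linearEquivOfInjective (g.inner p).toLinearMap
    (by
      rw [injective_iff_map_eq_zero]
      intro v hv
      by_contra h
      have h1 := g.pos p v h
      have h2 : g.inner p v v = 0 := by
        have := congrArg (fun f : TangentSpace I p →L[ℝ] ℝ ↦ f v) hv
        simpa using this
      exact absurd h2 h1.ne')
    (by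
      change Module.finrank ℝ E = Module.finrank ℝ (E →L[ℝ] ℝ)
      rw [← (LinearMap.toContinuousLinearMap (𝕜 := ℝ) (E := E) (F' := ℝ)).finrank_eq]
      exact (Subspace.dual_finrank_eq (K := ℝ) (V := E)).symm)

@[simp] lemma flat_apply (p : M) (v w : TangentSpace I p) :
    flat g p v w = g.inner p v w := rfl

@[simp] lemma inner_flat_symm (p : M) (f : TangentSpace I p →L[ℝ] ℝ)
    (w : TangentSpace I p) : g.inner p ((flat g p).symm f) w = f w := by
  rw [← flat_apply, LinearEquiv.apply_symm_apply]

lemma ext_inner (p : M) {v w : TangentSpace I p}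
    (h : ∀ u, g.inner p v u = g.inner p w u) : v = w :=
  (flat g p).injective (by ext u; exact h u)

/-- Half of the right-hand side of the Koszul formula, that is `g(∇_X Y, Z)` at `p`. -/
def koszul (X Y Z : Π x : M, TangentSpace I x) (p : M) : ℝ :=
  (mvfderiv I (pairing g Y Z) p (X p) + mvfderiv I (pairing g Z X) p (Y p)
    - mvfderiv I (pairing g X Y) p (Z p) + g.inner p (mlieBracket I X Y p) (Z p)
    - g.inner p (mlieBracket I Y Z p) (X p) + g.inner p (mlieBracket I Z X p) (Y p)) / 2

variable {X X' Y Y' Z Z' : Π x : M, TangentSpace I x} {p : M}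

lemma pairing_add_left : pairing g (X + X') Y = fun q ↦ pairing g X Y q + pairing g X' Y q := by
  ext q; simp [pairing]
lemma pairing_add_right : pairing g Y (X + X') = fun q ↦ pairing g Y X q + pairing g Y X' q := by
  ext q; simp [pairing]
lemma pairing_smul_left (f : M → ℝ) : pairing g (f • X) Y = fun q ↦ f q * pairing g X Y q := by
  ext q; simp [pairing]
lemma pairing_smul_right (f : M → ℝ) : pairing g Y (f • X) = fun q ↦ f q * pairing g Y X q := by
  ext q; simp [pairing]

lemma tensorialAt_koszul_left (hY : MDiffAt (T% Y) p) (hZ : MDiffAt (T% Z) p) :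
    TensorialAt I E (fun X ↦ koszul g X Y Z p) p where
  smul {f X} hf hX := by
    have hXY := mdifferentiableAt_pairing g hX hY
    have hZX := mdifferentiableAt_pairing g hZ hX
    simp only [koszul, pairing_smul_left, pairing_smul_right]
    rw [mvfderiv_fun_mul hf hZX, mvfderiv_fun_mul hf hXY, mlieBracket_smul_left hf hX,
      mlieBracket_smul_right hf hX]
    simp [pairing, g.symm p (X p)]
    ring
  add {X X'} hX hX' := by
    have hXY := mdifferentiableAt_pairing g hX hY
    have hZX := mdifferentiableAt_pairing g hZ hX
    have hXY' := mdifferentiableAt_pairing g hX' hY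
    have hZX' := mdifferentiableAt_pairing g hZ hX'
    simp only [koszul, pairing_add_left, pairing_add_right]
    rw [mvfderiv_fun_add hZX hZX', mvfderiv_fun_add hXY hXY', mlieBracket_add_left hX hX',
      mlieBracket_add_right hX hX']
    simp
    ring

lemma tensorialAt_koszul_right (hX : MDiffAt (T% X) p) (hY : MDiffAt (T% Y) p) :
    TensorialAt I E (fun Z ↦ koszul g X Y Z p) p where
  smul {f Z} hf hZ := by
    have hYZ := mdifferentiableAt_pairing g hY hZ
    have hZX := mdifferentiableAt_pairing g hZ hX
    simp only [koszul, pairing_smul_left, pairing_smul_right]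
    rw [mvfderiv_fun_mul hf hZX, mvfderiv_fun_mul hf hYZ, mlieBracket_smul_left hf hZ,
      mlieBracket_smul_right hf hZ]
    simp [pairing, g.symm p (Z p)]
    ring
  add {Z Z'} hZ hZ' := by
    have hYZ := mdifferentiableAt_pairing g hY hZ
    have hZX := mdifferentiableAt_pairing g hZ hX
    have hYZ' := mdifferentiableAt_pairing g hY hZ'
    have hZX' := mdifferentiableAt_pairing g hZ' hX
    simp only [koszul, pairing_add_left, pairing_add_right]
    rw [mvfderiv_fun_add hZX hZX', mvfderiv_fun_add hYZ hYZ', mlieBracket_add_left hZ hZ',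
      mlieBracket_add_right hZ hZ']
    simp
    ring

lemma koszul_add (hX : MDiffAt (T% X) p) (hY : MDiffAt (T% Y) p) (hY' : MDiffAt (T% Y') p)
    (hZ : MDiffAt (T% Z) p) :
    koszul g X (Y + Y') Z p = koszul g X Y Z p + koszul g X Y' Z p := by
  have hXY := mdifferentiableAt_pairing g hX hY
  have hYZ := mdifferentiableAt_pairing g hY hZ
  have hXY' := mdifferentiableAt_pairing g hX hY'
  have hYZ' := mdifferentiableAt_pairing g hY' hZ
  simp only [koszul, pairing_add_left, pairing_add_right]
  rw [mvfderiv_fun_add hYZ hYZ', mvfderiv_fun_add hXY hXY', mlieBracket_add_left hY hY',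
    mlieBracket_add_right hY hY']
  simp
  ring

lemma koszul_smul {f : M → ℝ} (hf : MDiffAt f p) (hX : MDiffAt (T% X) p)
    (hY : MDiffAt (T% Y) p) (hZ : MDiffAt (T% Z) p) :
    koszul g X (f • Y) Z p =
      f p * koszul g X Y Z p + mvfderiv I f p (X p) * g.inner p (Y p) (Z p) := by
  have hXY := mdifferentiableAt_pairing g hX hY
  have hYZ := mdifferentiableAt_pairing g hY hZ
  simp only [koszul, pairing_smul_left, pairing_smul_right]
  rw [mvfderiv_fun_mul hf hYZ, mvfderiv_fun_mul hf hXY, mlieBracket_smul_left hf hY,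
    mlieBracket_smul_right hf hY]
  simp [pairing, g.symm p (Y p)]
  ring

open Classical in
/-- `∇Y` at `p`, as an endomorphism of `T_pM`, defined by the Koszul formula. Fields that
are not differentiable at `p` get the value `0`. -/
def leviCivitaAux (Y : Π x : M, TangentSpace I x) (p : M) :
    TangentSpace I p →L[ℝ] TangentSpace I p :=
  if hY : MDiffAt (T% Y) p then
    haveI : FiniteDimensional ℝ (TangentSpace I p →L[ℝ] ℝ) :=
      inferInstanceAs (FiniteDimensional ℝ (E →L[ℝ] ℝ))
    (LinearMap.toContinuousLinearMap (flat g p).symm.toLinearMap).comp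
      (TensorialAt.mkHom₂ (fun X Z ↦ koszul g X Y Z p) p
        (fun _ hZ ↦ tensorialAt_koszul_left g hY hZ)
        (fun _ hX ↦ tensorialAt_koszul_right g hX hY))
  else 0

lemma inner_leviCivitaAux (hX : MDiffAt (T% X) p) (hY : MDiffAt (T% Y) p)
    (hZ : MDiffAt (T% Z) p) :
    g.inner p (leviCivitaAux g Y p (X p)) (Z p) = koszul g X Y Z p := by
  rw [leviCivitaAux, dif_pos hY]
  simp
  exact TensorialAt.mkHom₂_apply (Φ := fun X Z ↦ koszul g X Y Z p) _ _ hX hZ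

lemma exists_ext (v : TangentSpace I p) :
    ∃ X : Π x : M, TangentSpace I x, MDiffAt (T% X) p ∧ X p = v :=
  ⟨FiberBundle.extend E v, FiberBundle.mdifferentiableAt_extend .., by simp⟩

/-- The Levi-Civita connection of `g`. -/
def leviCivita : CovariantDerivative I E (TangentSpace I : M → Type _) where
  toFun := leviCivitaAux g
  isCovariantDerivativeOnUniv :=
    { add := by
        intro Y Y' p hY hY' _
        ext v
        apply ext_inner g p
        intro w
        obtain ⟨X, hX, rfl⟩ := exists_ext v
        obtain ⟨Z, hZ, rfl⟩ := exists_ext w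
        rw [inner_leviCivitaAux g hX (mdifferentiableAt_add_section hY hY') hZ, koszul_add g hX hY hY' hZ]
        simp [inner_leviCivitaAux g hX hY hZ, inner_leviCivitaAux g hX hY' hZ]
      leibniz := by
        intro Y f p hY hf _
        ext v
        apply ext_inner g p
        intro w
        obtain ⟨X, hX, rfl⟩ := exists_ext v
        obtain ⟨Z, hZ, rfl⟩ := exists_ext w
        rw [inner_leviCivitaAux g hX (hf.smul_section hY) hZ, koszul_smul g hf hX hY hZ]
        simp [inner_leviCivitaAux g hX hY hZ] }

lemma inner_leviCivita (hX : MDiffAt (T% X) p) (hY : MDiffAt (T% Y) p)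
    (hZ : MDiffAt (T% Z) p) :
    g.inner p (leviCivita g Y p (X p)) (Z p) = koszul g X Y Z p :=
  inner_leviCivitaAux g hX hY hZ

/-- The Levi-Civita connection is torsion free. -/
lemma leviCivita_torsion : (leviCivita g).torsion = 0 := by
  rw [CovariantDerivative.torsion_eq_zero_iff]
  intro X Y p hX hY
  apply ext_inner g p
  intro w
  obtain ⟨Z, hZ, rfl⟩ := exists_ext w
  rw [map_sub, sub_apply, inner_leviCivita g hX hY hZ, inner_leviCivita g hY hX hZ]
  simp only [koszul, pairing_comm g Y X, pairing_comm g Z X, pairing_comm g Z Y,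
    mlieBracket_swap_apply (V := Y) (W := X), mlieBracket_swap_apply (V := Z) (W := X),
    mlieBracket_swap_apply (V := Z) (W := Y)]
  simp
  ring

/-- The Levi-Civita connection is compatible with the metric. -/
lemma leviCivita_metric (hX : MDiffAt (T% X) p) (hY : MDiffAt (T% Y) p)
    (hZ : MDiffAt (T% Z) p) :
    mvfderiv I (pairing g Y Z) p (X p) =
      g.inner p (leviCivita g Y p (X p)) (Z p) + g.inner p (Y p) (leviCivita g Z p (X p)) := by
  rw [g.symm p (Y p), inner_leviCivita g hX hY hZ, inner_leviCivita g hX hZ hY]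
  simp only [koszul, pairing_comm g Y X, pairing_comm g Z X, pairing_comm g Z Y,
    mlieBracket_swap_apply (V := Y) (W := X), mlieBracket_swap_apply (V := Z) (W := X),
    mlieBracket_swap_apply (V := Z) (W := Y)]
  simp
  ring

/-- The gradient of `f`: the vector field with `g(grad f, w) = df(w)`. -/
def grad (f : M → ℝ) (p : M) : TangentSpace I p := (flat g p).symm (mvfderiv I f p)

/-- The Hessian `∇²f = ∇(grad f)` at `p`, as an endomorphism of `T_pM`. -/
def hess (f : M → ℝ) (p : M) : TangentSpace I p →L[ℝ] TangentSpace I p :=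
  leviCivita g (grad g f) p

/-- The Laplacian `Δf = tr ∇²f = div (grad f)`. -/
def laplacian (f : M → ℝ) (p : M) : ℝ := LinearMap.trace ℝ (TangentSpace I p) (hess g f p)

/-- An endomorphism `A` of `TM` is self-adjoint with respect to `g`. -/
def IsSelfAdjointFor (A : Π p : M, TangentSpace I p →L[ℝ] TangentSpace I p) : Prop :=
  ∀ (p : M) (v w : TangentSpace I p), g.inner p (A p v) w = g.inner p v (A p w)

/-- The Hessian of `f` is positive semidefinite: `g(∇²f(v), v) ≥ 0` for all `v`. (The Hessian of
a smooth function is always self-adjoint, because `∇` is torsion free and metric.) -/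
def HasPosSemidefHessian (f : M → ℝ) : Prop :=
  ∀ (p : M) (v : TangentSpace I p), 0 ≤ g.inner p (hess g f p v) v

/-- The Lie derivative `(𝓛_V g)(X, Y) = V(g(X, Y)) - g([V, X], Y) - g(X, [V, Y])`. -/
def lieDerivMetric (V X Y : Π x : M, TangentSpace I x) (p : M) : ℝ :=
  mvfderiv I (pairing g X Y) p (V p) - g.inner p (mlieBracket I V X p) (Y p)
    - g.inner p (X p) (mlieBracket I V Y p)

/-- The metric `g` is `V`-linear of slope `a`: `𝓛_V g = a g`. -/
def IsLinearMetric (V : Π x : M, TangentSpace I x) (a : ℝ) : Prop :=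
  ∀ (X Y : Π x : M, TangentSpace I x) (p : M), MDiffAt (T% X) p → MDiffAt (T% Y) p →
    lieDerivMetric g V X Y p = a * g.inner p (X p) (Y p)

/-- `U(M; V)`: the positive smooth functions `f` with `V f = f`, that is the positive smooth
functions that are `V`-linear of slope `1`. -/
structure IsPositiveLinear (V : Π x : M, TangentSpace I x) (f : M → ℝ) : Prop where
  smooth : ContMDiff I 𝓘(ℝ, ℝ) ∞ f
  linear : ∀ p, mvfderiv I f p (V p) = f p
  pos : ∀ p, 0 < f p

/-- The vector field `V` on the `d`-manifold `M` is cylindrical, with cross-section the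
codimension one submanifold `ι : Y → M`: it is transverse to `Y`, and its flow
defines a diffeomorphism `ℝ × Y ≃ M`. -/
structure IsCylindrical {d : ℕ} (m : ℕ)
    {M : Type*} [TopologicalSpace M] [ChartedSpace (EuclideanSpace ℝ (Fin d)) M]
    {Y : Type*} [TopologicalSpace Y] [ChartedSpace (EuclideanSpace ℝ (Fin m)) Y]
    (V : Π x : M, TangentSpace (𝓡 d) x) (ι : Y → M) : Prop where
  codim : m + 1 = d
  embedding : IsSmoothEmbedding (𝓡 m) (𝓡 d) ∞ ι
  transverse : ∀ y, (mfderiv (𝓡 m) (𝓡 d) ι y).range ⊔ Submodule.span ℝ {V (ι y)} = ⊤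
  flow : ∃ Φ : Diffeomorph (𝓘(ℝ, ℝ).prod (𝓡 m)) (𝓡 d) (ℝ × Y) M ∞,
    ∀ y, Φ (0, y) = ι y ∧ IsMIntegralCurve (fun t ↦ Φ (t, y)) V

section Volume

variable {d : ℕ} {M : Type*} [TopologicalSpace M] [ChartedSpace (EuclideanSpace ℝ (Fin d)) M]
  [IsManifold (𝓡 d) ∞ M] (g : SmoothMetric (𝓡 d) M)

/-- The matrix `g_ij = g(∂_i, ∂_j)` of `g` in the coordinates `φ` given by the preferred chart
at `x`, at the point with coordinates `y`. -/
def gramMatrix (x : M) (y : EuclideanSpace ℝ (Fin d)) : Matrix (Fin d) (Fin d) ℝ :=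
  Matrix.of fun i j ↦ g.inner ((extChartAt (𝓡 d) x).symm y)
    (mfderiv 𝓘(ℝ, EuclideanSpace ℝ (Fin d)) (𝓡 d) (extChartAt (𝓡 d) x).symm y
      (EuclideanSpace.single i 1))
    (mfderiv 𝓘(ℝ, EuclideanSpace ℝ (Fin d)) (𝓡 d) (extChartAt (𝓡 d) x).symm y
      (EuclideanSpace.single j 1))

/-- The measure `√(det g_ij) dy` on the domain of the preferred chart at `x`, extended by zero
to `M`. -/
def chartVolume [MeasurableSpace M] (x : M) : Measure M :=
  ((volume.restrict (extChartAt (𝓡 d) x).target).withDensity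
    fun y ↦ ENNReal.ofReal (Real.sqrt (gramMatrix g x y).det)).map (extChartAt (𝓡 d) x).symm

/-- The Riemannian volume measure `μ_g`: the least measure which dominates `√(det g_ij) dy` in
every chart. Since these local measures agree on overlaps, `μ_g` restricts to
`√(det g_ij) dy` on each chart domain. -/
def riemannianVolume [MeasurableSpace M] : Measure M := ⨆ x : M, chartVolume g x

/-- The Laplacian functional `S(f) = ∫_{f ≤ 1} Δf dμ_g`. -/
def laplacianFunctional [MeasurableSpace M] (f : M → ℝ) : ℝ :=
  ∫ p in {p | f p ≤ 1}, laplacian g f p ∂(riemannianVolume g)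

end Volume

end LaplacianFunctional

end

/-!
The identity `L_V g = g` with `∇V` self-adjoint forces `∇V = 1/2`. Hence `V` is half the radial
field of a metric cone, a function `F` of slope `1` satisfies `⟨∇F, V⟩ = F` and `∇²F(V, ·) = dF/2`,
and Cauchy–Schwarz for a positive semidefinite Hessian gives `|∇F|² ≤ 2 F ΔF`.

Let `F_t = G + t (H - G)`. Integration by parts, with the scaling along `V` trading `χ'(F_t)` for
`χ(F_t)`, gives `∫ χ(F_t) ΔF_t = d/2 ∫ χ(F_t) |∇F_t|² / F_t` for every cutoff `χ`, and bounds the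
`t`-derivative of the left-hand side by `(L - 1) d² / 2` times itself. Grönwall's inequality
compares `t = 0` with `t = 1`. Then `χ` tends to the indicator of `{F ≤ 1}`, with a bound that is
uniform near the vertex of the cone.
-/

namespace LaplacianFunctional

open Bundle Manifold MeasureTheory VectorField

section LinearAlgebra

variable {ι : Type*} [Fintype ι] [DecidableEq ι]

section BilinForm

variable {R W : Type*} [CommRing R] [AddCommGroup W] [Module R W] {B : LinearMap.BilinForm R W}
  {b : Module.Basis ι R W}

lemma repr_eq_sum_inv_toMatrix_mul (hB : IsUnit (LinearMap.BilinForm.toMatrix b B).det)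
    (w : W) (i : ι) :
    b.repr w i = ∑ k, (LinearMap.BilinForm.toMatrix b B)⁻¹ k i * B w (b k) := by
  have hw : (fun k ↦ B w (b k)) =
      Matrix.vecMul (b.repr w) (LinearMap.BilinForm.toMatrix b B) := by
    funext k
    conv_lhs => rw [← b.sum_repr w]
    simp only [map_sum, LinearMap.sum_apply, map_smul, LinearMap.smul_apply, smul_eq_mul,
      Matrix.vecMul, dotProduct, LinearMap.BilinForm.toMatrix_apply]
  have hinv : Matrix.vecMul (fun k ↦ B w (b k)) (LinearMap.BilinForm.toMatrix b B)⁻¹ =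
      b.repr w := by
    rw [hw, Matrix.vecMul_vecMul, Matrix.mul_nonsing_inv _ hB, Matrix.vecMul_one]
  simpa only [Matrix.vecMul, dotProduct, mul_comm] using (congrFun hinv i).symm

lemma trace_eq_sum_inv_toMatrix_mul (hB : IsUnit (LinearMap.BilinForm.toMatrix b B).det)
    (A : W →ₗ[R] W) :
    LinearMap.trace R W A =
      ∑ i, ∑ k, (LinearMap.BilinForm.toMatrix b B)⁻¹ k i * B (A (b i)) (b k) := by
  rw [LinearMap.trace_eq_matrix_trace R b, Matrix.trace]
  simp only [Matrix.diag_apply, LinearMap.toMatrix_apply, repr_eq_sum_inv_toMatrix_mul hB]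

end BilinForm

lemma norm_apply_sq_le_trace_mul_inner {W : Type*} [NormedAddCommGroup W] [InnerProductSpace ℝ W]
    [FiniteDimensional ℝ W] {A : W →ₗ[ℝ] W} (hA : A.IsPositive) (w : W) :
    ‖A w‖ ^ 2 ≤ LinearMap.trace ℝ W A * inner ℝ (A w) w := by
  let e := stdOrthonormalBasis ℝ W
  have cauchySchwarz (i) :
      inner ℝ (e i) (A w) ^ 2 ≤ inner ℝ (e i) (A (e i)) * inner ℝ (A w) w := by
    have := LinearMap.BilinForm.apply_mul_apply_le_of_forall_zero_le
      (innerₗ W ∘ₗ A) (fun v ↦ hA.inner_nonneg_left v) (e i) w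
    simp only [LinearMap.comp_apply, innerₗ_apply_apply] at this
    rwa [hA.isSymmetric (e i) w, hA.isSymmetric (e i) (e i), real_inner_comm (e i), ← sq] at this
  calc ‖A w‖ ^ 2 = ∑ i, inner ℝ (e i) (A w) ^ 2 := (e.sum_sq_inner_right (A w)).symm
    _ ≤ ∑ i, inner ℝ (e i) (A (e i)) * inner ℝ (A w) w :=
        Finset.sum_le_sum fun i _ ↦ cauchySchwarz i
    _ = LinearMap.trace ℝ W A * inner ℝ (A w) w := by
        rw [LinearMap.trace_eq_sum_inner A e, Finset.sum_mul]

lemma det_updateRow_eq_sum_adjugate {R : Type*} [CommRing R] (A : Matrix ι ι R) (i : ι)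
    (r : ι → R) : (A.updateRow i r).det = ∑ j, A.adjugate j i * r j := by
  rw [← Matrix.cramer_transpose_apply, Matrix.cramer_eq_adjugate_mulVec, Matrix.mulVec,
    ← Matrix.adjugate_transpose]
  rfl

lemma hasFDerivAt_det {𝕜 F : Type*} [NontriviallyNormedField 𝕜] [NormedAddCommGroup F]
    [NormedSpace 𝕜 F] {A : F → Matrix ι ι 𝕜} {A' : ι → ι → F →L[𝕜] 𝕜} {y : F}
    (hA : ∀ i j, HasFDerivAt (fun z ↦ A z i j) (A' i j) y) :
    HasFDerivAt (fun z ↦ (A z).det) (∑ i, ∑ j, (A y).adjugate j i • A' i j) y := by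
  let D : ContinuousMultilinearMap 𝕜 (fun _ : ι ↦ ι → 𝕜) 𝕜 :=
    { (Matrix.detRowAlternating (n := ι) (R := 𝕜)).toMultilinearMap with
      cont := Continuous.matrix_det continuous_id }
  have hrows : HasFDerivAt (fun z i j ↦ A z i j)
      (ContinuousLinearMap.pi fun i ↦ ContinuousLinearMap.pi fun j ↦ A' i j) y :=
    hasFDerivAt_pi.2 fun i ↦ hasFDerivAt_pi.2 fun j ↦ hA i j
  convert! (D.hasFDerivAt (fun i j ↦ A y i j)).comp y hrows using 1
  ext v
  simp only [ContinuousLinearMap.comp_apply, ContinuousMultilinearMap.linearDeriv_apply,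
    sum_apply, smul_apply, smul_eq_mul]
  exact Finset.sum_congr rfl fun i _ ↦
    (det_updateRow_eq_sum_adjugate (A y) i fun j ↦ A' i j v).symm

lemma hasFDerivAt_sqrt_det {F : Type*} [NormedAddCommGroup F] [NormedSpace ℝ F]
    {A : F → Matrix ι ι ℝ} {A' : ι → ι → F →L[ℝ] ℝ} {y : F}
    (hA : ∀ i j, HasFDerivAt (fun z ↦ A z i j) (A' i j) y) (hpos : 0 < (A y).det) :
    HasFDerivAt (fun z ↦ √(A z).det)
      ((√(A y).det / 2) • ∑ i, ∑ j, (A y)⁻¹ j i • A' i j) y := by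
  have hsqrt : √(A y).det / 2 * (A y).det⁻¹ = 1 / (2 * √(A y).det) := by
    have := Real.sq_sqrt hpos.le
    have := (Real.sqrt_pos.2 hpos).ne'
    field_simp
    linarith
  convert! (hasFDerivAt_det hA).sqrt hpos.ne' using 1
  simp only [Matrix.inv_def, Matrix.smul_apply, Ring.inverse_eq_inv', smul_assoc,
    ← Finset.smul_sum]
  rw [← mul_smul, hsqrt]

variable {E : Type*} [NormedAddCommGroup E] [NormedSpace ℝ E] {H : Type*} [TopologicalSpace H]
  {I : ModelWithCorners ℝ E H} {M : Type*} [TopologicalSpace M] [ChartedSpace H M]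
  {n : WithTop ℕ∞} {A : M → Matrix ι ι ℝ} {p : M}

lemma contMDiffAt_det (hA : ∀ i j, ContMDiffAt I 𝓘(ℝ) n (fun q ↦ A q i j) p) :
    ContMDiffAt I 𝓘(ℝ) n (fun q ↦ (A q).det) p := by
  simp only [Matrix.det_apply']
  exact ContMDiffAt.sum fun σ _ ↦ contMDiffAt_const.mul (ContMDiffAt.prod fun i _ ↦ hA _ _)

lemma contMDiffAt_inv_apply (hA : ∀ i j, ContMDiffAt I 𝓘(ℝ) n (fun q ↦ A q i j) p)
    (hdet : (A p).det ≠ 0) (i j : ι) : ContMDiffAt I 𝓘(ℝ) n (fun q ↦ (A q)⁻¹ i j) p := by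
  have hadj : ContMDiffAt I 𝓘(ℝ) n (fun q ↦ (A q).adjugate i j) p := by
    simp only [Matrix.adjugate_apply]
    refine contMDiffAt_det fun k l ↦ ?_
    by_cases hk : k = j
    · subst hk
      simpa only [Matrix.updateRow_self] using contMDiffAt_const
    · simpa only [Matrix.updateRow_ne hk] using hA k l
  simp only [Matrix.inv_def, Ring.inverse_eq_inv', Matrix.smul_apply, smul_eq_mul]
  exact ((contMDiffAt_det hA).inv₀ hdet).mul hadj

end LinearAlgebra

section CoordinateFields

variable {E : Type*} [NormedAddCommGroup E] [NormedSpace ℝ E]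
  {H : Type*} [TopologicalSpace H] {I : ModelWithCorners ℝ E H}
  {M : Type*} [TopologicalSpace M] [ChartedSpace H M]

lemma extChartAt_symm_mem_source (x : M) {y : E} (hy : y ∈ (extChartAt I x).target) :
    (extChartAt I x).symm y ∈ (chartAt H x).source := by
  simpa using (extChartAt I x).map_target hy

variable [IsManifold I ∞ M] {ι : Type*} (b : Module.Basis ι ℝ E) (x : M) {p : M} {f : M → ℝ}

variable (I) in
/-- The coordinate vector field `∂_i` of the preferred chart at `x`, where the model space `E`
carries the coordinates of the basis `b`. It vanishes outside the chart domain. -/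
noncomputable def coordField (i : ι) : Π p : M, TangentSpace I p :=
  (trivializationAt E (TangentSpace I) x).localFrame b i

/-- The coordinate vector fields as a basis of `T_pM`, for `p` in the chart domain. -/
noncomputable def coordBasis (hp : p ∈ (chartAt H x).source) :
    Module.Basis ι ℝ (TangentSpace I p) :=
  (trivializationAt E (TangentSpace I) x).basisAt b (by simpa using hp)

variable (I) in
/-- The coefficient of the vector field `X` along `∂_i`. -/
noncomputable def coordComp (X : Π p : M, TangentSpace I p) (i : ι) (p : M) : ℝ :=
  (trivializationAt E (TangentSpace I) x).localFrameCoeff I b i p (X p)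

@[simp] lemma coordBasis_apply (hp : p ∈ (chartAt H x).source) (i : ι) :
    coordBasis b x hp i = coordField I b x i p :=
  (Trivialization.localFrame_apply_of_mem_baseSet _ _ (by simpa using hp)).symm

lemma coordComp_eq_repr (X : Π p : M, TangentSpace I p) (i : ι) (hp : p ∈ (chartAt H x).source) :
    coordComp I b x X i p = (coordBasis b x hp).repr (X p) i :=
  Trivialization.localFrameCoeff_apply_of_mem_baseSet _ b (by simpa using hp) X i

lemma eq_sum_coordComp [Fintype ι] (X : Π p : M, TangentSpace I p)
    (hp : p ∈ (chartAt H x).source) :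
    X p = ∑ i, coordComp I b x X i p • coordField I b x i p :=
  Trivialization.eq_sum_localFrameCoeff_smul (s := X) (by simpa using hp)

lemma contMDiffAt_coordField (i : ι) (hp : p ∈ (chartAt H x).source) :
    ContMDiffAt I (I.prod 𝓘(ℝ, E)) ∞ (T% (coordField I b x i)) p :=
  contMDiffAt_localFrame_of_mem (n := ∞) _ _ i (by simpa using hp)

lemma mdifferentiableAt_coordField (i : ι) (hp : p ∈ (chartAt H x).source) :
    MDiffAt (T% (coordField I b x i)) p :=
  (contMDiffAt_coordField b x i hp).mdifferentiableAt (by simp)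

section Components

variable [FiniteDimensional ℝ E] {X : Π p : M, TangentSpace I p}

lemma mdifferentiableAt_coordComp (hX : MDiffAt (T% X) p) (i : ι)
    (hp : p ∈ (chartAt H x).source) : MDiffAt (coordComp I b x X i) p :=
  mdifferentiableAt_localFrameCoeff b (by simpa using hp) hX i

lemma contMDiffAt_coordComp {n : ℕ∞} (hX : ContMDiffAt I (I.prod 𝓘(ℝ, E)) n (T% X) p) (i : ι)
    (hp : p ∈ (chartAt H x).source) : ContMDiffAt I 𝓘(ℝ) n (coordComp I b x X i) p :=
  contMDiffAt_localFrameCoeff b (by simpa using hp) hX i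

lemma contMDiffAt_of_coordComp [Finite ι] {n : ℕ∞} (hp : p ∈ (chartAt H x).source)
    (hX : ∀ i, ContMDiffAt I 𝓘(ℝ) n (coordComp I b x X i) p) :
    ContMDiffAt I (I.prod 𝓘(ℝ, E)) n (T% X) p :=
  (contMDiffAt_iff_localFrameCoeff (e := trivializationAt E (TangentSpace I) x) b
    (by simpa using hp)).2 hX

end Components

variable [I.Boundaryless]

lemma contMDiffAt_extChartAt_symm {n : ℕ∞} {y : E} (hy : y ∈ (extChartAt I x).target) :
    ContMDiffAt 𝓘(ℝ, E) I n (extChartAt I x).symm y :=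
  ((contMDiffOn_extChartAt_symm (n := ∞) x).of_le (by exact_mod_cast le_top)).contMDiffAt
    ((isOpen_extChartAt_target x).mem_nhds hy)

lemma contDiffAt_comp_extChartAt_symm {n : ℕ∞} {y : E} (hy : y ∈ (extChartAt I x).target)
    (hf : ContMDiffAt I 𝓘(ℝ) n f ((extChartAt I x).symm y)) :
    ContDiffAt ℝ n (f ∘ (extChartAt I x).symm) y :=
  (hf.comp y (contMDiffAt_extChartAt_symm x hy)).contDiffAt

lemma differentiableAt_comp_extChartAt_symm {y : E} (hy : y ∈ (extChartAt I x).target)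
    (hf : MDiffAt f ((extChartAt I x).symm y)) :
    DifferentiableAt ℝ (f ∘ (extChartAt I x).symm) y :=
  (hf.comp y ((contMDiffAt_extChartAt_symm (n := 1) x hy).mdifferentiableAt
    (by simp))).differentiableAt

lemma coordField_eq_mfderiv (i : ι) (hp : p ∈ (chartAt H x).source) :
    coordField I b x i p =
      mfderiv 𝓘(ℝ, E) I (extChartAt I x).symm (extChartAt I x p) (b i) := by
  have hp' : p ∈ (trivializationAt E (TangentSpace I) x).baseSet := by simpa using hp
  have hsymmL := TangentBundle.symmL_trivializationAt (I := I) hp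
  rw [I.range_eq_univ, mfderivWithin_univ] at hsymmL
  rw [coordField, Trivialization.localFrame_apply_of_mem_baseSet _ _ hp',
    Trivialization.basisAt, Module.Basis.map_apply]
  exact (Trivialization.symmL_apply _ hp' _).symm.trans
    (congrArg (fun T : E →L[ℝ] E ↦ T (b i)) hsymmL)

lemma mvfderiv_coordField (hf : MDiffAt f p) (i : ι) (hp : p ∈ (chartAt H x).source) :
    mvfderiv I f p (coordField I b x i p) =
      fderiv ℝ (f ∘ (extChartAt I x).symm) (extChartAt I x p) (b i) := by
  have hp' : p ∈ (extChartAt I x).source := by simpa using hp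
  rw [coordField_eq_mfderiv b x i hp]
  refine (mvfderiv_comp_apply_of_eq _ hf ((contMDiffAt_extChartAt_symm (n := 1) x
    ((extChartAt I x).map_source hp')).mdifferentiableAt (by simp))
    ((extChartAt I x).left_inv hp') (b i)).symm.trans ?_
  rw [mvfderiv, mfderiv_eq_fderiv]
  rfl

lemma mvfderiv_coordField_extChartAt_symm {y : E} (hy : y ∈ (extChartAt I x).target)
    (hf : MDiffAt f ((extChartAt I x).symm y)) (i : ι) :
    mvfderiv I f ((extChartAt I x).symm y) (coordField I b x i ((extChartAt I x).symm y)) =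
      fderiv ℝ (f ∘ (extChartAt I x).symm) y (b i) := by
  rw [mvfderiv_coordField b x hf i (extChartAt_symm_mem_source x hy),
    (extChartAt I x).right_inv hy]

lemma contMDiffAt_mvfderiv_coordField (hf : ContMDiff I 𝓘(ℝ) ∞ f) (i : ι)
    (hp : p ∈ (chartAt H x).source) :
    ContMDiffAt I 𝓘(ℝ) ∞ (fun q ↦ mvfderiv I f q (coordField I b x i q)) p := by
  have hp' : p ∈ (extChartAt I x).source := by simpa using hp
  have hfderiv : ContDiffAt ℝ ∞ (fun z ↦ fderiv ℝ (f ∘ (extChartAt I x).symm) z (b i))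
      (extChartAt I x p) :=
    ((contDiffAt_comp_extChartAt_symm (n := ⊤) x ((extChartAt I x).map_source hp')
      (hf _)).fderiv_right (m := ∞) (by simp)).clm_apply contDiffAt_const
  refine (hfderiv.contMDiffAt.comp p (contMDiffAt_extChartAt' (n := ∞) hp)).congr_of_eventuallyEq
    ?_
  filter_upwards [(chartAt H x).open_source.mem_nhds hp] with q hq
  exact mvfderiv_coordField b x (hf.mdifferentiableAt (by simp)) i hq

lemma mvfderiv_mvfderiv_coordField_comm (hf : ContMDiff I 𝓘(ℝ) ∞ f) (i j : ι)
    (hp : p ∈ (chartAt H x).source) :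
    mvfderiv I (fun q ↦ mvfderiv I f q (coordField I b x j q)) p (coordField I b x i p) =
      mvfderiv I (fun q ↦ mvfderiv I f q (coordField I b x i q)) p (coordField I b x j p) := by
  have hy : extChartAt I x p ∈ (extChartAt I x).target :=
    (extChartAt I x).map_source (by simpa using hp)
  set F := f ∘ (extChartAt I x).symm
  have hF_smooth : ContDiffAt ℝ ∞ F (extChartAt I x p) :=
    contDiffAt_comp_extChartAt_symm (n := ⊤) x hy (hf _)
  have hF' : DifferentiableAt ℝ (fderiv ℝ F) (extChartAt I x p) :=
    (hF_smooth.fderiv_right (m := ∞) (by simp)).differentiableAt (by simp)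
  have second_deriv (k l : ι) :
      mvfderiv I (fun q ↦ mvfderiv I f q (coordField I b x l q)) p (coordField I b x k p) =
        fderiv ℝ (fderiv ℝ F) (extChartAt I x p) (b k) (b l) := by
    have hcoord : (fun q ↦ mvfderiv I f q (coordField I b x l q)) ∘ (extChartAt I x).symm
        =ᶠ[nhds (extChartAt I x p)] fun z ↦ fderiv ℝ F z (b l) := by
      filter_upwards [(isOpen_extChartAt_target x).mem_nhds hy] with z hz
      exact mvfderiv_coordField_extChartAt_symm b x hz (hf.mdifferentiableAt (by simp)) l
    rw [mvfderiv_coordField b x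
      ((contMDiffAt_mvfderiv_coordField b x hf l hp).mdifferentiableAt (by simp)) k hp,
      hcoord.fderiv_eq, fderiv_clm_apply hF' (differentiableAt_const _)]
    simp
  rw [second_deriv, second_deriv]
  exact hF_smooth.isSymmSndFDerivAt
    (by rw [minSmoothness_of_isRCLikeNormedField]; exact ENat.LEInfty.out) (b i) (b j)

lemma mlieBracket_eq_lieBracket (V W : Π y : E, TangentSpace 𝓘(ℝ, E) y) :
    mlieBracket 𝓘(ℝ, E) V W = lieBracket ℝ V W := by
  rw [← mlieBracketWithin_univ, mlieBracketWithin_eq_lieBracketWithin]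
  exact lieBracketWithin_univ

lemma mlieBracket_const (v w y : E) :
    mlieBracket 𝓘(ℝ, E) (fun z : E ↦ (v : TangentSpace 𝓘(ℝ, E) z))
      (fun z : E ↦ (w : TangentSpace 𝓘(ℝ, E) z)) y = 0 := by
  refine (congrFun (mlieBracket_eq_lieBracket _ _) y).trans ?_
  change fderiv ℝ (fun _ : E ↦ w) y v - fderiv ℝ (fun _ : E ↦ v) y w = 0
  simp

lemma coordField_eq_mpullback (i : ι) (hp : p ∈ (chartAt H x).source) :
    coordField I b x i p = mpullback I 𝓘(ℝ, E) (extChartAt I x) (fun _ : E ↦ (b i : E)) p := by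
  have hp' : p ∈ (extChartAt I x).source := by simpa using hp
  have hright := mfderiv_extChartAt_comp_mfderivWithin_extChartAt_symm' (I := I) hp'
  have hleft := mfderivWithin_extChartAt_symm_comp_mfderiv_extChartAt' (I := I) hp'
  simp only [I.range_eq_univ, mfderivWithin_univ] at hright hleft
  rw [coordField_eq_mfderiv b x i hp]
  exact (congrArg (fun T : E →L[ℝ] E ↦ T (b i))
    (ContinuousLinearMap.inverse_eq hright hleft)).symm

lemma mlieBracket_coordField [CompleteSpace E] (i j : ι) (hp : p ∈ (chartAt H x).source) :
    mlieBracket I (coordField I b x i) (coordField I b x j) p = 0 := by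
  have hpullback (i : ι) : coordField I b x i =ᶠ[nhds p]
      mpullback I 𝓘(ℝ, E) (extChartAt I x) (fun _ : E ↦ (b i : E)) := by
    filter_upwards [(chartAt H x).open_source.mem_nhds hp] with q hq
    exact coordField_eq_mpullback b x i hq
  have hconst (v : E) : MDifferentiableAt 𝓘(ℝ, E) 𝓘(ℝ, E).tangent
      (fun y : E ↦ (⟨y, v⟩ : TangentBundle 𝓘(ℝ, E) E)) (extChartAt I x p) := by
    rw [mdifferentiableAt_totalSpace]
    exact ⟨mdifferentiableAt_id, by simpa using mdifferentiableAt_const⟩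
  have : IsManifold I (minSmoothness ℝ 2) M := by
    rw [minSmoothness_of_isRCLikeNormedField]; infer_instance
  rw [(hpullback i).mlieBracket_vectorField_eq (hpullback j),
    ← mpullback_mlieBracket (n := ∞) (hconst (b i)) (hconst (b j)) (contMDiffAt_extChartAt' hp)
      (by rw [minSmoothness_of_isRCLikeNormedField]; exact ENat.LEInfty.out)]
  exact (congrArg _ (mlieBracket_const (b i) (b j) _)).trans (map_zero _)

end CoordinateFields

section GramMatrix

variable {E : Type*} [NormedAddCommGroup E] [NormedSpace ℝ E]
  {H : Type*} [TopologicalSpace H] {I : ModelWithCorners ℝ E H}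
  {M : Type*} [TopologicalSpace M] [ChartedSpace H M] [IsManifold I ∞ M] (g : SmoothMetric I M)

lemma contMDiffAt_pairing {p : M} {n : ℕ∞} {X Y : Π p : M, TangentSpace I p}
    (hX : ContMDiffAt I (I.prod 𝓘(ℝ, E)) n (T% X) p)
    (hY : ContMDiffAt I (I.prod 𝓘(ℝ, E)) n (T% Y) p) :
    ContMDiffAt I 𝓘(ℝ) n (pairing g X Y) p := by
  have hg := (g.contMDiff p).of_le (m := n) (by exact_mod_cast le_top)
  have hpairing : ContMDiffAt I (I.prod 𝓘(ℝ)) n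
      (fun m ↦ TotalSpace.mk' ℝ (E := Bundle.Trivial M ℝ) m (g.inner m (X m) (Y m))) p := by
    apply ContMDiffAt.clm_bundle_apply₂ (F₁ := E) (F₂ := E)
    · exact hg
    · exact hX
    · exact hY
  exact (contMDiffAt_totalSpace.1 hpairing).2

variable {ι : Type*} (b : Module.Basis ι ℝ E) (x : M) {p : M}

/-- The matrix `g_ij = g(∂_i, ∂_j)` in the preferred chart at `x`, as a function on the manifold;
`gramMatrix` is its counterpart on the chart target. -/
noncomputable def coordGram (p : M) : Matrix ι ι ℝ :=
  Matrix.of fun i j ↦ pairing g (coordField I b x i) (coordField I b x j) p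

lemma contMDiffAt_coordGram (i j : ι) (hp : p ∈ (chartAt H x).source) :
    ContMDiffAt I 𝓘(ℝ) ∞ (fun q ↦ coordGram g b x q i j) p :=
  contMDiffAt_pairing g (contMDiffAt_coordField b x i hp) (contMDiffAt_coordField b x j hp)

lemma mdifferentiableAt_coordGram (i j : ι) (hp : p ∈ (chartAt H x).source) :
    MDiffAt (fun q ↦ coordGram g b x q i j) p :=
  (contMDiffAt_coordGram g b x i j hp).mdifferentiableAt (by simp)

lemma coordGram_isSymm (p : M) : (coordGram g b x p).IsSymm := by
  ext i j
  exact g.symm p _ _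

variable [Fintype ι] [DecidableEq ι]

lemma toMatrix_coordBasis_inner (hp : p ∈ (chartAt H x).source) :
    LinearMap.BilinForm.toMatrix (coordBasis b x hp) (g.inner p).toLinearMap₁₂ =
      coordGram g b x p := by
  ext i j
  rw [LinearMap.BilinForm.toMatrix_apply, coordBasis_apply, coordBasis_apply]
  rfl

lemma coordGram_det_pos (hp : p ∈ (chartAt H x).source) : 0 < (coordGram g b x p).det := by
  rw [← toMatrix_coordBasis_inner g b x hp]
  exact ((LinearMap.BilinForm.posDef_toQuadraticMap_iff_matrix _ _ ⟨fun v w ↦ g.symm p v w⟩).1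
    fun v hv ↦ g.pos p v hv).det_pos

lemma coordBasis_repr_eq_sum (hp : p ∈ (chartAt H x).source) (v : TangentSpace I p) (i : ι) :
    (coordBasis b x hp).repr v i =
      ∑ k, (coordGram g b x p)⁻¹ k i * g.inner p v (coordField I b x k p) := by
  have hdet : IsUnit (LinearMap.BilinForm.toMatrix (coordBasis b x hp)
      (g.inner p).toLinearMap₁₂).det := by
    rw [toMatrix_coordBasis_inner]
    exact (coordGram_det_pos g b x hp).ne'.isUnit
  simpa only [toMatrix_coordBasis_inner, coordBasis_apply,
    ContinuousLinearMap.toLinearMap₁₂_apply_apply_apply] using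
    repr_eq_sum_inv_toMatrix_mul hdet v i

lemma trace_eq_sum_coordGram (hp : p ∈ (chartAt H x).source)
    (A : TangentSpace I p →L[ℝ] TangentSpace I p) :
    LinearMap.trace ℝ (TangentSpace I p) A = ∑ i, ∑ k, (coordGram g b x p)⁻¹ k i *
      g.inner p (A (coordField I b x i p)) (coordField I b x k p) := by
  have hdet : IsUnit (LinearMap.BilinForm.toMatrix (coordBasis b x hp)
      (g.inner p).toLinearMap₁₂).det := by
    rw [toMatrix_coordBasis_inner]
    exact (coordGram_det_pos g b x hp).ne'.isUnit
  simpa only [toMatrix_coordBasis_inner, coordBasis_apply,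
    ContinuousLinearMap.toLinearMap₁₂_apply_apply_apply, ContinuousLinearMap.coe_coe] using
    trace_eq_sum_inv_toMatrix_mul hdet A.toLinearMap

end GramMatrix

section Hessian

variable {E : Type*} [NormedAddCommGroup E] [NormedSpace ℝ E] [FiniteDimensional ℝ E]
  {H : Type*} [TopologicalSpace H] {I : ModelWithCorners ℝ E H}
  {M : Type*} [TopologicalSpace M] [ChartedSpace H M] [IsManifold I ∞ M] (g : SmoothMetric I M)
  {p : M} {f : M → ℝ}

lemma inner_grad (f : M → ℝ) (v : TangentSpace I p) :
    g.inner p (grad g f p) v = mvfderiv I f p v := inner_flat_symm g p _ v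

lemma leviCivita_sub_leviCivita {X Y : Π p : M, TangentSpace I p} (hX : MDiffAt (T% X) p)
    (hY : MDiffAt (T% Y) p) :
    leviCivita g Y p (X p) - leviCivita g X p (Y p) = mlieBracket I X Y p := by
  have htorsion := (leviCivita g).torsion_apply hX hY
  rw [leviCivita_torsion] at htorsion
  exact sub_eq_zero.1 (htorsion.symm.trans (by simp))

variable [I.Boundaryless] {ι : Type*} (b : Module.Basis ι ℝ E) (x : M)

lemma leviCivita_coordField_comm (i j : ι) (hp : p ∈ (chartAt H x).source) :
    leviCivita g (coordField I b x j) p (coordField I b x i p) =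
      leviCivita g (coordField I b x i) p (coordField I b x j p) :=
  sub_eq_zero.1 <| (leviCivita_sub_leviCivita g (mdifferentiableAt_coordField b x i hp)
    (mdifferentiableAt_coordField b x j hp)).trans
      (mlieBracket_coordField b x i j hp)

lemma contMDiff_grad (hf : ContMDiff I 𝓘(ℝ) ∞ f) :
    ContMDiff I (I.prod 𝓘(ℝ, E)) ∞ (T% (grad g f)) := by
  intro p
  have hp : p ∈ (chartAt H p).source := mem_chart_source H p
  let b := Module.finBasis ℝ E
  refine contMDiffAt_of_coordComp (n := ⊤) b p hp fun i ↦ ?_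
  have hcomp : ContMDiffAt I 𝓘(ℝ) ∞ (fun q ↦ ∑ k, (coordGram g b p q)⁻¹ k i *
      mvfderiv I f q (coordField I b p k q)) p :=
    ContMDiffAt.sum fun k _ ↦ (contMDiffAt_inv_apply
      (fun i j ↦ contMDiffAt_coordGram g b p i j hp)
      (coordGram_det_pos g b p hp).ne' k i).mul (contMDiffAt_mvfderiv_coordField b p hf k hp)
  refine hcomp.congr_of_eventuallyEq ?_
  filter_upwards [(chartAt H p).open_source.mem_nhds hp] with q hq
  rw [coordComp_eq_repr b p _ i hq, coordBasis_repr_eq_sum g b p hq]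
  simp only [inner_grad]

lemma mdifferentiableAt_grad (hf : ContMDiff I 𝓘(ℝ) ∞ f) : MDiffAt (T% (grad g f)) p :=
  (contMDiff_grad g hf).mdifferentiableAt (by simp)

lemma contMDiff_pairing_grad {u : M → ℝ} (hf : ContMDiff I 𝓘(ℝ) ∞ f)
    (hu : ContMDiff I 𝓘(ℝ) ∞ u) : ContMDiff I 𝓘(ℝ) ∞ (pairing g (grad g f) (grad g u)) :=
  fun p ↦ contMDiffAt_pairing (n := ⊤) g (contMDiff_grad g hf p) (contMDiff_grad g hu p)

lemma inner_hess (hf : ContMDiff I 𝓘(ℝ) ∞ f) {X Y : Π p : M, TangentSpace I p}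
    (hX : MDiffAt (T% X) p) (hY : MDiffAt (T% Y) p) :
    g.inner p (hess g f p (X p)) (Y p) =
      mvfderiv I (fun q ↦ mvfderiv I f q (Y q)) p (X p) -
        mvfderiv I f p (leviCivita g Y p (X p)) := by
  have hmetric := leviCivita_metric g hX (mdifferentiableAt_grad g hf) hY
  have hpairing : pairing g (grad g f) Y = fun q ↦ mvfderiv I f q (Y q) :=
    funext fun q ↦ inner_grad g f (Y q)
  rw [hpairing, inner_grad] at hmetric
  rw [hmetric, hess, add_sub_cancel_right]

lemma hess_symm (hf : ContMDiff I 𝓘(ℝ) ∞ f) (v w : TangentSpace I p) :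
    g.inner p (hess g f p v) w = g.inner p v (hess g f p w) := by
  have hp : p ∈ (chartAt H p).source := mem_chart_source H p
  let b := Module.finBasis ℝ E
  let hessForm : LinearMap.BilinForm ℝ (TangentSpace I p) :=
    (g.inner p ∘L hess g f p).toLinearMap₁₂
  have hflip : hessForm = hessForm.flip := by
    refine LinearMap.BilinForm.ext_basis (coordBasis b p hp) fun i j ↦ ?_
    rw [coordBasis_apply, coordBasis_apply]
    change g.inner p (hess g f p (coordField I b p i p)) (coordField I b p j p) =
      g.inner p (hess g f p (coordField I b p j p)) (coordField I b p i p)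
    rw [inner_hess g hf (mdifferentiableAt_coordField b p i hp)
        (mdifferentiableAt_coordField b p j hp),
      inner_hess g hf (mdifferentiableAt_coordField b p j hp)
        (mdifferentiableAt_coordField b p i hp),
      mvfderiv_mvfderiv_coordField_comm b p hf i j hp, leviCivita_coordField_comm g b p i j hp]
  exact (LinearMap.congr_fun₂ hflip v w).trans (g.symm p _ _)

end Hessian

section Divergence

variable {E : Type*} [NormedAddCommGroup E] [NormedSpace ℝ E] [FiniteDimensional ℝ E]
  {H : Type*} [TopologicalSpace H] {I : ModelWithCorners ℝ E H}
  {M : Type*} [TopologicalSpace M] [ChartedSpace H M] [IsManifold I ∞ M]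
  (g : SmoothMetric I M) {X Y : Π p : M, TangentSpace I p} {f : M → ℝ} {p : M}

/-- The divergence `tr ∇X` of a vector field. -/
noncomputable def divergence (X : Π p : M, TangentSpace I p) (p : M) : ℝ :=
  LinearMap.trace ℝ (TangentSpace I p) (leviCivita g X p)

lemma laplacian_eq_divergence (f : M → ℝ) : laplacian g f = divergence g (grad g f) := rfl

lemma divergence_zero (p : M) : divergence g (0 : Π p : M, TangentSpace I p) p = 0 := by
  rw [divergence, (leviCivita g).zero]
  exact map_zero _

lemma divergence_add (hX : MDiffAt (T% X) p) (hY : MDiffAt (T% Y) p) :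
    divergence g (X + Y) p = divergence g X p + divergence g Y p := by
  rw [divergence, show leviCivita g (X + Y) p = leviCivita g X p + leviCivita g Y p from
    (leviCivita g).isCovariantDerivativeOnUniv.add hX hY, ContinuousLinearMap.toLinearMap_add,
    map_add]
  rfl

lemma divergence_smul (hX : MDiffAt (T% X) p) (hf : MDiffAt f p) :
    divergence g (f • X) p = f p * divergence g X p + mvfderiv I f p (X p) := by
  have : FiniteDimensional ℝ (TangentSpace I p) := inferInstanceAs (FiniteDimensional ℝ E)
  rw [divergence, show leviCivita g (f • X) p =
      f p • leviCivita g X p + (mvfderiv I f p).smulRight (X p) from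
    (leviCivita g).isCovariantDerivativeOnUniv.leibniz hX hf,
    ContinuousLinearMap.toLinearMap_add, map_add, ContinuousLinearMap.toLinearMap_smul, map_smul]
  exact congrArg (f p * divergence g X p + ·)
    (LinearMap.trace_smulRight (mvfderiv I f p).toLinearMap (X p))

lemma divergence_sum {κ : Type*} (s : Finset κ) {X : κ → Π p : M, TangentSpace I p}
    (hX : ∀ i ∈ s, MDiffAt (T% (X i)) p) :
    divergence g (∑ i ∈ s, X i) p = ∑ i ∈ s, divergence g (X i) p := by
  classical
  suffices MDiffAt (T% (∑ i ∈ s, X i)) p ∧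
      divergence g (∑ i ∈ s, X i) p = ∑ i ∈ s, divergence g (X i) p from this.2
  induction s using Finset.induction_on with
  | empty =>
    simp only [Finset.sum_empty]
    exact ⟨mdifferentiableAt_zeroSection .., divergence_zero g p⟩
  | insert i s hi ih =>
    obtain ⟨hs, hdiv⟩ := ih fun j hj ↦ hX j (Finset.mem_insert_of_mem hj)
    have hi' := hX i (Finset.mem_insert_self i s)
    rw [Finset.sum_insert hi, Finset.sum_insert hi, ← hdiv]
    exact ⟨mdifferentiableAt_add_section hi' hs, divergence_add g hi' hs⟩

lemma divergence_congr (hX : MDiffAt (T% X) p) (h : ∀ᶠ q in nhds p, X q = Y q) :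
    divergence g X p = divergence g Y p := by
  have hY : MDiffAt (T% Y) p := by
    refine hX.congr_of_eventuallyEq ?_
    filter_upwards [h] with q hq
    rw [hq]
  rw [divergence, (leviCivita g).isCovariantDerivativeOnUniv.congr_of_eventuallyEq hX hY
    Filter.univ_mem h, divergence]

variable {ι : Type*} (b : Module.Basis ι ℝ E) (x : M)

lemma divergence_eq_sum_coordComp [Fintype ι] (hX : MDiffAt (T% X) p)
    (hp : p ∈ (chartAt H x).source) :
    divergence g X p = ∑ j, (coordComp I b x X j p * divergence g (coordField I b x j) p +
      mvfderiv I (coordComp I b x X j) p (coordField I b x j p)) := by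
  have hfield (i : ι) : MDiffAt (T% (coordField I b x i)) p := mdifferentiableAt_coordField b x i hp
  have hcomp (i : ι) : MDiffAt (coordComp I b x X i) p := mdifferentiableAt_coordComp b x hX i hp
  have hsum : ∀ᶠ q in nhds p, X q = (∑ i, coordComp I b x X i • coordField I b x i) q := by
    filter_upwards [(chartAt H x).open_source.mem_nhds hp] with q hq
    simpa using eq_sum_coordComp b x X hq
  rw [divergence_congr g hX hsum,
    divergence_sum g _ fun i _ ↦ (hcomp i).smul_section (hfield i)]
  exact Finset.sum_congr rfl fun i _ ↦ divergence_smul g (hfield i) (hcomp i)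

variable [I.Boundaryless]

lemma mvfderiv_coordGram (i j k : ι) (hp : p ∈ (chartAt H x).source) :
    mvfderiv I (fun q ↦ coordGram g b x q i k) p (coordField I b x j p) =
      g.inner p (leviCivita g (coordField I b x j) p (coordField I b x i p))
          (coordField I b x k p) +
        g.inner p (leviCivita g (coordField I b x j) p (coordField I b x k p))
          (coordField I b x i p) := by
  refine (leviCivita_metric g (mdifferentiableAt_coordField b x j hp)
    (mdifferentiableAt_coordField b x i hp) (mdifferentiableAt_coordField b x k hp)).trans ?_
  rw [leviCivita_coordField_comm g b x j i hp, leviCivita_coordField_comm g b x j k hp,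
    g.symm p (coordField I b x i p)]

variable [Fintype ι] [DecidableEq ι]

lemma divergence_coordField (j : ι) (hp : p ∈ (chartAt H x).source) :
    divergence g (coordField I b x j) p = (∑ i, ∑ k, (coordGram g b x p)⁻¹ k i *
      mvfderiv I (fun q ↦ coordGram g b x q i k) p (coordField I b x j p)) / 2 := by
  have htrace := trace_eq_sum_coordGram g b x hp (leviCivita g (coordField I b x j) p)
  have htrace_swap : ∑ i, ∑ k, (coordGram g b x p)⁻¹ k i * g.inner p
      (leviCivita g (coordField I b x j) p (coordField I b x k p)) (coordField I b x i p) =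
      ∑ i, ∑ k, (coordGram g b x p)⁻¹ k i * g.inner p
        (leviCivita g (coordField I b x j) p (coordField I b x i p)) (coordField I b x k p) := by
    rw [Finset.sum_comm]
    simp only [(coordGram_isSymm g b x p).inv.apply]
  simp only [mvfderiv_coordGram g b x _ j _ hp, mul_add, Finset.sum_add_distrib]
  rw [htrace_swap, ← htrace, divergence]
  ring

/-- The density `√(det g_ij)` of the Riemannian volume in the coordinates of the preferred chart
at `x`. -/
noncomputable def coordDensity (y : E) : ℝ := √(coordGram g b x ((extChartAt I x).symm y)).det

lemma fderiv_coordDensity {y : E} (hy : y ∈ (extChartAt I x).target) (j : ι) :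
    DifferentiableAt ℝ (coordDensity g b x) y ∧ fderiv ℝ (coordDensity g b x) y (b j) =
      coordDensity g b x y * divergence g (coordField I b x j) ((extChartAt I x).symm y) := by
  have hp := extChartAt_symm_mem_source x hy
  have hGram (i k : ι) := mdifferentiableAt_coordGram g b x i k hp
  have hDensity := hasFDerivAt_sqrt_det
    (fun i k ↦ (differentiableAt_comp_extChartAt_symm x hy (hGram i k)).hasFDerivAt)
    (coordGram_det_pos g b x hp)
  have hDensity' : HasFDerivAt (coordDensity g b x) _ y := hDensity
  refine ⟨hDensity'.differentiableAt, ?_⟩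
  rw [hDensity'.fderiv, divergence_coordField g b x j hp]
  simp only [mvfderiv_coordField_extChartAt_symm b x hy (hGram _ _), smul_apply, sum_apply,
    smul_eq_mul, coordDensity, Function.comp_apply]
  ring

lemma coordDensity_mul_divergence {y : E} (hy : y ∈ (extChartAt I x).target)
    (hX : MDiffAt (T% X) ((extChartAt I x).symm y)) :
    coordDensity g b x y * divergence g X ((extChartAt I x).symm y) =
      ∑ j, fderiv ℝ (fun z ↦ coordDensity g b x z *
        coordComp I b x X j ((extChartAt I x).symm z)) y (b j) := by
  have hp := extChartAt_symm_mem_source x hy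
  have hcomp (j : ι) := mdifferentiableAt_coordComp b x hX j hp
  rw [divergence_eq_sum_coordComp g b x hX hp, Finset.mul_sum]
  refine Finset.sum_congr rfl fun j _ ↦ ?_
  have hprod := fderiv_fun_mul (fderiv_coordDensity g b x hy j).1
      (differentiableAt_comp_extChartAt_symm x hy (hcomp j))
  simp only [Function.comp_apply] at hprod
  rw [hprod, mvfderiv_coordField_extChartAt_symm b x hy (hcomp j)]
  simp only [add_apply, smul_apply, smul_eq_mul, (fderiv_coordDensity g b x hy j).2,
    Function.comp_def]
  ring

end Divergence

section Transition

variable {E : Type*} [NormedAddCommGroup E] [NormedSpace ℝ E]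
  {H : Type*} [TopologicalSpace H] {I : ModelWithCorners ℝ E H} [I.Boundaryless]
  {M : Type*} [TopologicalSpace M] [ChartedSpace H M] [IsManifold I ∞ M] (x x' : M) {y : E}

variable (I) in
/-- The change of coordinates from the preferred chart at `x` to the preferred chart at `x'`. -/
noncomputable def chartTransition (x x' : M) : E → E := extChartAt I x' ∘ (extChartAt I x).symm

lemma differentiableAt_chartTransition (hy : y ∈ (extChartAt I x).target)
    (hy' : (extChartAt I x).symm y ∈ (chartAt H x').source) :
    DifferentiableAt ℝ (chartTransition I x x') y :=
  (((contMDiffAt_extChartAt' (n := ∞) hy').comp y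
    (contMDiffAt_extChartAt_symm (n := ⊤) x hy)).contDiffAt).differentiableAt (by simp)

lemma mfderiv_extChartAt_symm_apply (hy : y ∈ (extChartAt I x).target)
    (hy' : (extChartAt I x).symm y ∈ (chartAt H x').source) (v : E) :
    mfderiv 𝓘(ℝ, E) I (extChartAt I x).symm y v =
      mfderiv 𝓘(ℝ, E) I (extChartAt I x').symm (chartTransition I x x' y)
        (fderiv ℝ (chartTransition I x x') y v) := by
  have hp' : (extChartAt I x).symm y ∈ (extChartAt I x').source := by simpa using hy'
  have hsymm := (contMDiffAt_extChartAt_symm (I := I) (n := 1) x hy).mdifferentiableAt (by simp)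
  have hsymm' := (contMDiffAt_extChartAt_symm (I := I) (n := 1) x'
    ((extChartAt I x').map_source hp')).mdifferentiableAt (by simp)
  have heq : (extChartAt I x).symm =ᶠ[nhds y] (extChartAt I x').symm ∘ chartTransition I x x' := by
    filter_upwards [hsymm.continuousAt.preimage_mem_nhds
      ((isOpen_extChartAt_source x').mem_nhds hp')] with z hz
    exact ((extChartAt I x').left_inv hz).symm
  have hcomp := (HasMFDerivAt.comp (I := 𝓘(ℝ, E)) (I' := 𝓘(ℝ, E)) y hsymm'.hasMFDerivAt
    (differentiableAt_chartTransition x x' hy hy').hasFDerivAt.hasMFDerivAt).congr_of_eventuallyEq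
    heq
  exact congrArg (fun A : E →L[ℝ] E ↦ A v) hcomp.mfderiv

variable {ι : Type*} (b : Module.Basis ι ℝ E)

lemma coordField_extChartAt_symm (i : ι) (hy : y ∈ (extChartAt I x).target) :
    coordField I b x i ((extChartAt I x).symm y) =
      mfderiv 𝓘(ℝ, E) I (extChartAt I x).symm y (b i) := by
  rw [coordField_eq_mfderiv b x i (extChartAt_symm_mem_source x hy), (extChartAt I x).right_inv hy]

variable [Fintype ι]

lemma coordField_eq_sum_transition (hy : y ∈ (extChartAt I x).target)
    (hy' : (extChartAt I x).symm y ∈ (chartAt H x').source) (i : ι) :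
    coordField I b x i ((extChartAt I x).symm y) =
      ∑ k, b.repr (fderiv ℝ (chartTransition I x x') y (b i)) k •
        coordField I b x' k ((extChartAt I x).symm y) := by
  rw [coordField_extChartAt_symm x b i hy]
  refine (mfderiv_extChartAt_symm_apply x x' hy hy' (b i)).trans ?_
  let A : E →L[ℝ] TangentSpace I ((extChartAt I x).symm y) :=
    mfderiv 𝓘(ℝ, E) I (extChartAt I x').symm (chartTransition I x x' y)
  change A (fderiv ℝ (chartTransition I x x') y (b i)) = _
  conv_lhs => rw [← b.sum_repr (fderiv ℝ (chartTransition I x x') y (b i)), map_sum]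
  refine Finset.sum_congr rfl fun k _ ↦ ?_
  rw [map_smul, coordField_eq_mfderiv b x' k hy']
  rfl

variable [DecidableEq ι] (g : SmoothMetric I M)

lemma coordGram_eq_transpose_mul_mul (hy : y ∈ (extChartAt I x).target)
    (hy' : (extChartAt I x).symm y ∈ (chartAt H x').source) :
    coordGram g b x ((extChartAt I x).symm y) =
      (LinearMap.toMatrix b b (fderiv ℝ (chartTransition I x x') y)).transpose *
        coordGram g b x' ((extChartAt I x).symm y) *
        LinearMap.toMatrix b b (fderiv ℝ (chartTransition I x x') y) := by
  ext i j
  rw [coordGram, Matrix.of_apply, pairing, coordField_eq_sum_transition x x' b hy hy' i,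
    coordField_eq_sum_transition x x' b hy hy' j]
  simp only [map_sum, map_smul, sum_apply, smul_apply, smul_eq_mul, Matrix.mul_apply,
    Matrix.transpose_apply, LinearMap.toMatrix_apply, coordGram, Matrix.of_apply, pairing,
    Finset.mul_sum, Finset.sum_mul, ContinuousLinearMap.coe_coe]
  exact Finset.sum_congr rfl fun k _ ↦ Finset.sum_congr rfl fun l _ ↦ by ring

lemma coordDensity_eq_abs_det_mul (hy : y ∈ (extChartAt I x).target)
    (hy' : (extChartAt I x).symm y ∈ (chartAt H x').source) :
    coordDensity g b x y = |(fderiv ℝ (chartTransition I x x') y).det| *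
      coordDensity g b x' (chartTransition I x x' y) := by
  have hp' : (extChartAt I x).symm y ∈ (extChartAt I x').source := by simpa using hy'
  rw [coordDensity, coordDensity, coordGram_eq_transpose_mul_mul x x' b g hy hy', chartTransition,
    Function.comp_apply, (extChartAt I x').left_inv hp', Matrix.det_mul, Matrix.det_mul,
    Matrix.det_transpose, LinearMap.det_toMatrix, ContinuousLinearMap.det, mul_right_comm,
    Real.sqrt_mul (mul_self_nonneg _), Real.sqrt_mul_self_eq_abs]

end Transition

section Density

variable {E : Type*} [NormedAddCommGroup E] [NormedSpace ℝ E]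
  {H : Type*} [TopologicalSpace H] {I : ModelWithCorners ℝ E H}
  {M : Type*} [TopologicalSpace M] [ChartedSpace H M] [IsManifold I ∞ M]
  {ι : Type*} [Fintype ι] [DecidableEq ι] (b : Module.Basis ι ℝ E) (x : M) {y : E}
  (g : SmoothMetric I M)

lemma coordDensity_pos (hy : y ∈ (extChartAt I x).target) : 0 < coordDensity g b x y :=
  Real.sqrt_pos.2 (coordGram_det_pos g _ x (extChartAt_symm_mem_source x hy))

variable [I.Boundaryless]

lemma contDiffAt_coordDensity (hy : y ∈ (extChartAt I x).target) :
    ContDiffAt ℝ ∞ (coordDensity g b x) y := by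
  have hp := extChartAt_symm_mem_source x hy
  have hdet := contMDiffAt_det fun i j ↦ contMDiffAt_coordGram g b x i j hp
  exact (contDiffAt_comp_extChartAt_symm (n := ⊤) x hy hdet).sqrt (coordGram_det_pos g b x hp).ne'

lemma continuousOn_coordDensity : ContinuousOn (coordDensity g b x) (extChartAt I x).target :=
  fun _ hy ↦ (contDiffAt_coordDensity b x g hy).continuousAt.continuousWithinAt

end Density

section RiemannianVolume

lemma measurableSet_extChartAt_image {E : Type*} [NormedAddCommGroup E] [NormedSpace ℝ E]
    [MeasurableSpace E] [BorelSpace E] {H : Type*} [TopologicalSpace H]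
    {I : ModelWithCorners ℝ E H} [I.Boundaryless] {M : Type*} [TopologicalSpace M]
    [ChartedSpace H M] [MeasurableSpace M] [BorelSpace M] (x : M) {A : Set M}
    (hA : MeasurableSet A) (hAx : A ⊆ (extChartAt I x).source) :
    MeasurableSet (extChartAt I x '' A) := by
  have himage : extChartAt I x '' A =
      Subtype.val '' ((fun y : (extChartAt I x).target ↦ (extChartAt I x).symm y) ⁻¹' A) := by
    rw [(extChartAt I x).image_eq_target_inter_inv_preimage hAx]
    ext y
    simp [and_comm]
  rw [himage]
  exact (isOpen_extChartAt_target x).measurableSet.subtype_image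
    ((continuousOn_iff_continuous_domRestrict.1 (continuousOn_extChartAt_symm x)).measurable hA)

variable {d : ℕ} {M : Type*} [TopologicalSpace M] [ChartedSpace (EuclideanSpace ℝ (Fin d)) M]
  [IsManifold (𝓡 d) ∞ M] (g : SmoothMetric (𝓡 d) M) (x x' : M)

/-- The standard basis of Euclidean space, with respect to which `gramMatrix` is defined. -/
noncomputable abbrev stdBasis (d : ℕ) : Module.Basis (Fin d) ℝ (EuclideanSpace ℝ (Fin d)) :=
  (EuclideanSpace.basisFun (Fin d) ℝ).toBasis

lemma gramMatrix_eq_coordGram {y : EuclideanSpace ℝ (Fin d)}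
    (hy : y ∈ (extChartAt (𝓡 d) x).target) :
    gramMatrix g x y = coordGram g (stdBasis d) x ((extChartAt (𝓡 d) x).symm y) := by
  ext i j
  simp only [gramMatrix, coordGram, pairing, Matrix.of_apply, coordField_extChartAt_symm x _ _ hy,
    OrthonormalBasis.coe_toBasis, EuclideanSpace.basisFun_apply]

variable [MeasurableSpace M]

/-- The measure `√(det g_ij) dy` on the target of the preferred chart at `x`. -/
noncomputable def coordVolume : Measure (EuclideanSpace ℝ (Fin d)) :=
  (volume.restrict (extChartAt (𝓡 d) x).target).withDensity
    fun y ↦ ENNReal.ofReal (coordDensity g (stdBasis d) x y)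

lemma chartVolume_eq_map :
    chartVolume g x = (coordVolume g x).map (extChartAt (𝓡 d) x).symm := by
  rw [chartVolume, coordVolume]
  congr 1
  refine withDensity_congr_ae ?_
  filter_upwards [ae_restrict_mem (isOpen_extChartAt_target x).measurableSet] with y hy
  rw [gramMatrix_eq_coordGram g x hy, coordDensity]

variable [BorelSpace M]

lemma aemeasurable_extChartAt_symm :
    AEMeasurable (extChartAt (𝓡 d) x).symm (coordVolume g x) :=
  ((continuousOn_extChartAt_symm x).aemeasurable
    (isOpen_extChartAt_target x).measurableSet).mono_ac (withDensity_absolutelyContinuous _ _)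

lemma chartVolume_apply {A : Set M} (hA : MeasurableSet A)
    (hAx : A ⊆ (extChartAt (𝓡 d) x).source) : chartVolume g x A =
      ∫⁻ y in extChartAt (𝓡 d) x '' A, ENNReal.ofReal (coordDensity g (stdBasis d) x y) := by
  have hpreimage : NullMeasurableSet ((extChartAt (𝓡 d) x).symm ⁻¹' A)
      (volume.restrict (extChartAt (𝓡 d) x).target) :=
    ((continuousOn_extChartAt_symm x).aemeasurable
      (isOpen_extChartAt_target x).measurableSet).nullMeasurableSet_preimage hA
  rw [chartVolume_eq_map, Measure.map_apply_of_aemeasurable (aemeasurable_extChartAt_symm g x) hA,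
    coordVolume, withDensity_apply', Measure.restrict_restrict₀ hpreimage,
    (extChartAt (𝓡 d) x).image_eq_target_inter_inv_preimage hAx, Set.inter_comm]

lemma chartVolume_compl_source : chartVolume g x (extChartAt (𝓡 d) x).sourceᶜ = 0 := by
  have hsource := (isOpen_extChartAt_source (I := 𝓡 d) x).measurableSet
  rw [chartVolume_eq_map, Measure.map_apply_of_aemeasurable (aemeasurable_extChartAt_symm g x)
    hsource.compl]
  refine withDensity_absolutelyContinuous _ _ (ae_iff.1 ?_)
  filter_upwards [ae_restrict_mem (isOpen_extChartAt_target x).measurableSet] with y hy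
  exact (extChartAt (𝓡 d) x).map_target hy

lemma chartVolume_overlap {A : Set M} (hA : MeasurableSet A)
    (hAx : A ⊆ (extChartAt (𝓡 d) x).source) (hAx' : A ⊆ (extChartAt (𝓡 d) x').source) :
    chartVolume g x A = chartVolume g x' A := by
  rw [chartVolume_apply g x hA hAx, chartVolume_apply g x' hA hAx']
  have himage : extChartAt (𝓡 d) x' '' A =
      chartTransition (𝓡 d) x x' '' (extChartAt (𝓡 d) x '' A) := by
    rw [chartTransition, Set.image_comp,
      (extChartAt (𝓡 d) x).symm_image_image_of_subset_source hAx]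
  have htarget {y} (hy : y ∈ extChartAt (𝓡 d) x '' A) : y ∈ (extChartAt (𝓡 d) x).target :=
    (extChartAt (𝓡 d) x).mapsTo.image_subset (Set.image_mono hAx hy)
  have hsource' {y} (hy : y ∈ extChartAt (𝓡 d) x '' A) :
      (extChartAt (𝓡 d) x).symm y ∈ (extChartAt (𝓡 d) x').source := by
    obtain ⟨p, hp, rfl⟩ := hy
    rw [(extChartAt (𝓡 d) x).left_inv (hAx hp)]
    exact hAx' hp
  have hinj : Set.InjOn (chartTransition (𝓡 d) x x') (extChartAt (𝓡 d) x '' A) :=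
    (extChartAt (𝓡 d) x').injOn.comp
      ((extChartAt (𝓡 d) x).symm.injOn.mono fun _ hy ↦ htarget hy) fun _ hy ↦ hsource' hy
  have hmeas := measurableSet_extChartAt_image x hA hAx
  rw [himage, lintegral_image_eq_lintegral_abs_det_fderiv_mul volume hmeas (fun y hy ↦
    (differentiableAt_chartTransition x x' (htarget hy)
      (by simpa using hsource' hy)).hasFDerivAt.hasFDerivWithinAt) hinj]
  refine setLIntegral_congr_fun hmeas fun y hy ↦ ?_
  rw [coordDensity_eq_abs_det_mul x x' _ g (htarget hy) (by simpa using hsource' hy),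
    ENNReal.ofReal_mul (abs_nonneg _)]

lemma chartVolume_restrict_le (z : M) :
    (chartVolume g z).restrict (extChartAt (𝓡 d) x).source ≤ chartVolume g x := by
  have hsource (z : M) := (isOpen_extChartAt_source (I := 𝓡 d) z).measurableSet
  refine Measure.le_iff.2 fun A hA ↦ ?_
  rw [Measure.restrict_apply hA,
    ← measure_inter_conull (t := (extChartAt (𝓡 d) z).source) (chartVolume_compl_source g z),
    ← chartVolume_overlap g x z ((hA.inter (hsource x)).inter (hsource z))
      (fun q hq ↦ hq.1.2) (fun q hq ↦ hq.2)]
  exact measure_mono fun q hq ↦ hq.1.1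

lemma riemannianVolume_restrict_source :
    (riemannianVolume g).restrict (extChartAt (𝓡 d) x).source = chartVolume g x := by
  have hsource := (isOpen_extChartAt_source (I := 𝓡 d) x).measurableSet
  have hself : (chartVolume g x).restrict (extChartAt (𝓡 d) x).source = chartVolume g x :=
    Measure.restrict_eq_self_of_ae_mem (ae_iff.2 (chartVolume_compl_source g x))
  apply le_antisymm
  · have hle : riemannianVolume g ≤ chartVolume g x +
        (⊤ : Measure M).restrict (extChartAt (𝓡 d) x).sourceᶜ := by
      refine iSup_le fun z ↦ ?_
      rw [← Measure.restrict_add_restrict_compl (μ := chartVolume g z) hsource]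
      exact add_le_add (chartVolume_restrict_le g x z) (Measure.restrict_mono le_rfl le_top)
    refine (Measure.restrict_mono le_rfl hle).trans ?_
    rw [Measure.restrict_add, Measure.restrict_restrict hsource, Set.inter_compl_self,
      Measure.restrict_empty, add_zero, hself]
  · rw [← hself]
    exact Measure.restrict_mono le_rfl (le_iSup (fun z ↦ chartVolume g z) x)

end RiemannianVolume

section EuclideanIntegral

variable {E : Type*} [NormedAddCommGroup E] [NormedSpace ℝ E]
  [MeasurableSpace E] [BorelSpace E] (μ : Measure E)

lemma integrable_fderiv_of_hasCompactSupport [IsFiniteMeasureOnCompacts μ] {u : E → ℝ}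
    (hu : ContDiff ℝ 1 u) (hsupp : HasCompactSupport u) (v : E) :
    Integrable (fun y ↦ fderiv ℝ u y v) μ :=
  ((hu.continuous_fderiv (by simp)).clm_apply
    continuous_const).integrable_of_hasCompactSupport (hsupp.fderiv_apply ℝ v)

variable [FiniteDimensional ℝ E] [μ.IsAddHaarMeasure] {u : E → ℝ}

lemma integral_fderiv_eq_zero (hu : ContDiff ℝ 1 u) (hsupp : HasCompactSupport u) (v : E) :
    ∫ y, fderiv ℝ u y v ∂μ = 0 := by
  have hu_int : Integrable u μ := hu.continuous.integrable_of_hasCompactSupport hsupp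
  have hderiv_int := integrable_fderiv_of_hasCompactSupport μ hu hsupp v
  have hparts := integral_mul_fderiv_eq_neg_fderiv_mul_of_integrable (μ := μ)
    (f := fun _ : E ↦ (1 : ℝ)) (g := u) (v := v) (by simp) (by simpa using hderiv_int)
    (by simpa using hu_int) (fun y _ ↦ differentiableAt_const _)
    (fun y _ ↦ hu.differentiable (by simp) y)
  simpa using hparts

lemma integrableOn_fderiv_and_setIntegral_eq_zero {U K : Set E} (hU : IsOpen U)
    (hu : ∀ y ∈ U, ContDiffAt ℝ 1 u y) (hK : IsCompact K) (hKU : K ⊆ U)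
    (huK : ∀ y ∈ U, y ∉ K → u y = 0) (v : E) :
    IntegrableOn (fun y ↦ fderiv ℝ u y v) U μ ∧ ∫ y in U, fderiv ℝ u y v ∂μ = 0 := by
  have hzero : ∀ y ∉ K, U.indicator u y = 0 := fun y hy ↦ by
    by_cases hyU : y ∈ U
    · rw [Set.indicator_of_mem hyU, huK y hyU hy]
    · exact Set.indicator_of_notMem hyU _
  have hinside : ∀ y ∈ U, U.indicator u =ᶠ[nhds y] u := fun y hy ↦ by
    filter_upwards [hU.mem_nhds hy] with z hz using Set.indicator_of_mem hz _
  have houtside : ∀ y ∉ K, U.indicator u =ᶠ[nhds y] fun _ ↦ 0 := fun y hy ↦ by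
    filter_upwards [hK.isClosed.isOpen_compl.mem_nhds hy] with z hz using hzero z hz
  have hsmooth : ContDiff ℝ 1 (U.indicator u) := contDiff_iff_contDiffAt.2 fun y ↦ by
    by_cases hy : y ∈ K
    · exact (hu y (hKU hy)).congr_of_eventuallyEq (hinside y (hKU hy))
    · exact contDiffAt_const.congr_of_eventuallyEq (houtside y hy)
  have hsupp : HasCompactSupport (U.indicator u) := HasCompactSupport.intro hK hzero
  have hcongr : Set.EqOn (fun y ↦ fderiv ℝ (U.indicator u) y v) (fun y ↦ fderiv ℝ u y v) U :=
    fun y hy ↦ by simp only [(hinside y hy).fderiv_eq]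
  refine ⟨(integrable_fderiv_of_hasCompactSupport μ hsmooth hsupp v).integrableOn.congr_fun hcongr
    hU.measurableSet, ?_⟩
  rw [← setIntegral_congr_fun hU.measurableSet hcongr,
    setIntegral_eq_integral_of_forall_compl_eq_zero, integral_fderiv_eq_zero μ hsmooth hsupp]
  intro y hy
  rw [(houtside y fun hyK ↦ hy (hKU hyK)).fderiv_eq]
  simp

end EuclideanIntegral

section DivergenceSupport

variable {E : Type*} [NormedAddCommGroup E] [NormedSpace ℝ E] [FiniteDimensional ℝ E]
  {H : Type*} [TopologicalSpace H] {I : ModelWithCorners ℝ E H}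
  {M : Type*} [TopologicalSpace M] [ChartedSpace H M] [IsManifold I ∞ M] (g : SmoothMetric I M)
  {X : Π p : M, TangentSpace I p}

lemma divergence_eq_zero_of_notMem {K : Set M} (hK : IsClosed K) (hXK : ∀ p ∉ K, X p = 0) {p : M}
    (hp : p ∉ K) : divergence g X p = 0 := by
  have heq : ∀ᶠ q in nhds p, (0 : Π p : M, TangentSpace I p) q = X q := by
    filter_upwards [hK.isOpen_compl.mem_nhds hp] with q hq
    exact (hXK q hq).symm
  exact (divergence_congr g (mdifferentiableAt_zeroSection ..) heq).symm.trans (divergence_zero g p)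

variable [I.Boundaryless] {ι : Type*} [Fintype ι] [DecidableEq ι] (b : Module.Basis ι ℝ E)

lemma contDiffAt_coordDensity_mul_coordComp (x : M)
    (hX : ContMDiff I (I.prod 𝓘(ℝ, E)) ∞ (T% X)) (j : ι) {y : E}
    (hy : y ∈ (extChartAt I x).target) :
    ContDiffAt ℝ ∞ (fun z ↦ coordDensity g b x z *
      coordComp I b x X j ((extChartAt I x).symm z)) y :=
  (contDiffAt_coordDensity b x g hy).mul <|
    contDiffAt_comp_extChartAt_symm (n := ⊤) x hy
      (contMDiffAt_coordComp (n := ⊤) b x (hX _) j (extChartAt_symm_mem_source x hy))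

lemma continuous_divergence (hX : ContMDiff I (I.prod 𝓘(ℝ, E)) ∞ (T% X)) :
    Continuous (divergence g X) := by
  let b := Module.finBasis ℝ E
  refine continuous_iff_continuousAt.2 fun p ↦ ?_
  have hp : p ∈ (extChartAt I p).source := mem_extChartAt_source p
  have hy := (extChartAt I p).map_source hp
  have hcoord : ContinuousAt (fun y ↦ (coordDensity g b p y)⁻¹ * ∑ j, fderiv ℝ
      (fun z ↦ coordDensity g b p z * coordComp I b p X j ((extChartAt I p).symm z)) y (b j))
      (extChartAt I p p) := by
    refine ((contDiffAt_coordDensity b p g hy).continuousAt.inv₀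
      (coordDensity_pos b p g hy).ne').mul (tendsto_finsetSum _ fun j _ ↦ ?_)
    exact ((contDiffAt_coordDensity_mul_coordComp g b p hX j hy).fderiv_right (m := 0)
      (by simp)).continuousAt.clm_apply continuousAt_const
  refine (hcoord.comp (continuousAt_extChartAt p)).congr ?_
  filter_upwards [(isOpen_extChartAt_source p).mem_nhds hp] with q hq
  have hqy := (extChartAt I p).map_source hq
  rw [Function.comp_apply,
    ← coordDensity_mul_divergence g b p hqy (hX.mdifferentiableAt (by simp)),
    (extChartAt I p).left_inv hq, inv_mul_cancel_left₀ (coordDensity_pos b p g hqy).ne']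

end DivergenceSupport

lemma exists_finset_smooth_sum_eq_one {E : Type*} [NormedAddCommGroup E] [NormedSpace ℝ E]
    [FiniteDimensional ℝ E] {H : Type*} [TopologicalSpace H] (I : ModelWithCorners ℝ E H)
    {M : Type*} [TopologicalSpace M] [ChartedSpace H M] [IsManifold I ∞ M] [T2Space M]
    [SigmaCompactSpace M] {K : Set M} (hK : IsCompact K) :
    ∃ (S : Finset M) (ρ : M → M → ℝ), (∀ x, ContMDiff I 𝓘(ℝ) ∞ (ρ x)) ∧
      (∀ x, tsupport (ρ x) ⊆ (chartAt H x).source) ∧ ∀ p ∈ K, ∑ x ∈ S, ρ x p = 1 := by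
  obtain ⟨ρ, hρ⟩ := SmoothPartitionOfUnity.exists_isSubordinate_chartAt_source I M
  have hfinite : {x | (Function.support (ρ x) ∩ K).Nonempty}.Finite :=
    ρ.locallyFinite.finite_nonempty_inter_compact hK
  refine ⟨hfinite.toFinset, fun x ↦ ρ x, fun x ↦ (ρ x).contMDiff, hρ, fun p hp ↦ ?_⟩
  rw [← ρ.sum_eq_one (Set.mem_univ p)]
  refine (finsum_eq_sum_of_support_subset _ fun x hx ↦ ?_).symm
  exact hfinite.mem_toFinset.2 ⟨p, hx, hp⟩

section DivergenceTheorem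

variable {d : ℕ} {M : Type*} [TopologicalSpace M] [ChartedSpace (EuclideanSpace ℝ (Fin d)) M]
  [IsManifold (𝓡 d) ∞ M] (g : SmoothMetric (𝓡 d) M) [MeasurableSpace M] [BorelSpace M]
  {X : Π p : M, TangentSpace (𝓡 d) p}

instance : IsLocallyFiniteMeasure (riemannianVolume g) := by
  refine ⟨fun p ↦ ?_⟩
  have hp : p ∈ (extChartAt (𝓡 d) p).source := mem_extChartAt_source p
  obtain ⟨r, hr, hball⟩ := Metric.nhds_basis_closedBall.mem_iff.1
    ((isOpen_extChartAt_target p).mem_nhds ((extChartAt (𝓡 d) p).map_source hp))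
  have hcompact := isCompact_closedBall (extChartAt (𝓡 d) p p) r
  set U := (extChartAt (𝓡 d) p).source ∩
    extChartAt (𝓡 d) p ⁻¹' Metric.ball (extChartAt (𝓡 d) p p) r
  have hU : IsOpen U := (continuousOn_extChartAt p).isOpen_inter_preimage
    (isOpen_extChartAt_source p) Metric.isOpen_ball
  have hUsource : U ⊆ (extChartAt (𝓡 d) p).source := Set.inter_subset_left
  refine ⟨U, hU.mem_nhds ⟨hp, Metric.mem_ball_self hr⟩, ?_⟩
  obtain ⟨C, hC⟩ := hcompact.exists_bound_of_continuousOn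
    ((continuousOn_coordDensity (stdBasis d) p g).mono hball)
  have himage : extChartAt (𝓡 d) p '' U ⊆ Metric.closedBall (extChartAt (𝓡 d) p p) r := by
    rintro _ ⟨q, hq, rfl⟩
    exact Metric.ball_subset_closedBall hq.2
  calc riemannianVolume g U
      = ∫⁻ y in extChartAt (𝓡 d) p '' U, ENNReal.ofReal (coordDensity g (stdBasis d) p y) := by
        rw [← chartVolume_apply g p hU.measurableSet hUsource, ← riemannianVolume_restrict_source,
          Measure.restrict_apply hU.measurableSet, Set.inter_eq_left.2 hUsource]
    _ ≤ ∫⁻ y in Metric.closedBall (extChartAt (𝓡 d) p p) r,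
          ENNReal.ofReal (coordDensity g (stdBasis d) p y) := lintegral_mono_set himage
    _ ≤ ∫⁻ _ in Metric.closedBall (extChartAt (𝓡 d) p p) r, ENNReal.ofReal C :=
        setLIntegral_mono measurable_const fun y hy ↦
          ENNReal.ofReal_le_ofReal ((le_abs_self _).trans (hC y hy))
    _ < ⊤ := by
        rw [setLIntegral_const]
        exact ENNReal.mul_lt_top ENNReal.ofReal_lt_top hcompact.measure_lt_top

lemma integral_eq_setIntegral_chart (x : M) {f : M → ℝ} (hf : Continuous f)
    (hfx : ∀ p ∉ (extChartAt (𝓡 d) x).source, f p = 0) :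
    ∫ p, f p ∂(riemannianVolume g) = ∫ y in (extChartAt (𝓡 d) x).target,
      coordDensity g (stdBasis d) x y * f ((extChartAt (𝓡 d) x).symm y) := by
  have htarget := (isOpen_extChartAt_target (I := 𝓡 d) x).measurableSet
  rw [← setIntegral_eq_integral_of_forall_compl_eq_zero hfx, riemannianVolume_restrict_source,
    chartVolume_eq_map, integral_map (aemeasurable_extChartAt_symm g x)
      hf.measurable.aestronglyMeasurable, coordVolume,
    integral_withDensity_eq_integral_toReal_smul₀
      ((continuousOn_coordDensity _ x g).aemeasurable htarget).ennreal_ofReal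
      (Filter.Eventually.of_forall fun _ ↦ ENNReal.ofReal_lt_top)]
  refine setIntegral_congr_fun htarget fun y hy ↦ ?_
  simp only [ENNReal.toReal_ofReal (coordDensity_pos _ x g hy).le, smul_eq_mul]

variable [T2Space M]

lemma integral_divergence_eq_zero_of_subset_source (x : M)
    (hX : ContMDiff (𝓡 d) ((𝓡 d).prod 𝓘(ℝ, EuclideanSpace ℝ (Fin d))) ∞ (T% X)) {K : Set M}
    (hK : IsCompact K) (hXK : ∀ p ∉ K, X p = 0) (hKx : K ⊆ (extChartAt (𝓡 d) x).source) :
    ∫ p, divergence g X p ∂(riemannianVolume g) = 0 := by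
  have hKtarget : extChartAt (𝓡 d) x '' K ⊆ (extChartAt (𝓡 d) x).target :=
    (extChartAt (𝓡 d) x).mapsTo.mono_left hKx |>.image_subset
  have hcoord (j : Fin d) := integrableOn_fderiv_and_setIntegral_eq_zero volume
    (isOpen_extChartAt_target x)
    (fun y hy ↦ (contDiffAt_coordDensity_mul_coordComp g (stdBasis d) x hX j hy).of_le
      ENat.LEInfty.out)
    (hK.image_of_continuousOn ((continuousOn_extChartAt x).mono hKx)) hKtarget
    (fun y hy hyK ↦ by
      rw [coordComp, hXK _ fun hmem ↦ hyK ⟨_, hmem, (extChartAt (𝓡 d) x).right_inv hy⟩, map_zero,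
        mul_zero]) (stdBasis d j)
  rw [integral_eq_setIntegral_chart g x (continuous_divergence g hX) fun p hp ↦
      divergence_eq_zero_of_notMem g hK.isClosed hXK fun hpK ↦ hp (hKx hpK),
    setIntegral_congr_fun (isOpen_extChartAt_target x).measurableSet fun y hy ↦
      coordDensity_mul_divergence g (stdBasis d) x hy (hX.mdifferentiableAt (by simp)),
    integral_finsetSum _ fun j _ ↦ (hcoord j).1]
  exact Finset.sum_eq_zero fun j _ ↦ (hcoord j).2

theorem integral_divergence_eq_zero [SigmaCompactSpace M]
    (hX : ContMDiff (𝓡 d) ((𝓡 d).prod 𝓘(ℝ, EuclideanSpace ℝ (Fin d))) ∞ (T% X)) {K : Set M}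
    (hK : IsCompact K) (hXK : ∀ p ∉ K, X p = 0) :
    ∫ p, divergence g X p ∂(riemannianVolume g) = 0 := by
  obtain ⟨S, ρ, hρ, hρ_supp, hρ_sum⟩ := exists_finset_smooth_sum_eq_one (𝓡 d) hK
  have hsmooth (x : M) : ContMDiff (𝓡 d) ((𝓡 d).prod 𝓘(ℝ, EuclideanSpace ℝ (Fin d))) ∞
      (T% (ρ x • X)) := (hρ x).smul_section hX
  have hdecomp : X = ∑ x ∈ S, ρ x • X := by
    funext p
    by_cases hp : p ∈ K
    · simp only [Finset.sum_apply, Pi.smul_apply', ← Finset.sum_smul, hρ_sum p hp, one_smul]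
    · simp [hXK p hp]
  have hcompact (x : M) : IsCompact (K ∩ tsupport (ρ x)) := hK.inter_right (isClosed_tsupport _)
  have hzero (x : M) : ∀ p ∉ K ∩ tsupport (ρ x), (ρ x • X) p = 0 := fun p hp ↦ by
    by_cases hpK : p ∈ K
    · rw [Pi.smul_apply', image_eq_zero_of_notMem_tsupport fun hmem ↦ hp ⟨hpK, hmem⟩, zero_smul]
    · rw [Pi.smul_apply', hXK p hpK, smul_zero]
  have hint (x : M) : Integrable (divergence g (ρ x • X)) (riemannianVolume g) :=
    (continuous_divergence g (hsmooth x)).integrable_of_hasCompactSupport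
      (HasCompactSupport.intro (hcompact x) fun p hp ↦
        divergence_eq_zero_of_notMem g (hcompact x).isClosed (hzero x) hp)
  have hdiv (p : M) : divergence g X p = ∑ x ∈ S, divergence g (ρ x • X) p := by
    conv_lhs => rw [hdecomp]
    exact divergence_sum g S fun x _ ↦ (hsmooth x).mdifferentiableAt (by simp)
  simp only [hdiv]
  rw [integral_finsetSum _ fun x _ ↦ hint x]
  refine Finset.sum_eq_zero fun x _ ↦ integral_divergence_eq_zero_of_subset_source g x (hsmooth x)
    (hcompact x) (hzero x) ?_
  rw [extChartAt_source]
  exact Set.inter_subset_right.trans (hρ_supp x)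

end DivergenceTheorem

section Slope

variable {E : Type*} [NormedAddCommGroup E] [NormedSpace ℝ E]
  {H : Type*} [TopologicalSpace H] {I : ModelWithCorners ℝ E H}
  {M : Type*} [TopologicalSpace M] [ChartedSpace H M]
  {V : Π p : M, TangentSpace I p} {f u : M → ℝ} {a b : ℝ} {p : M}

lemma mvfderiv_real_comp {χ : ℝ → ℝ} (hχ : DifferentiableAt ℝ χ (f p)) (hf : MDiffAt f p)
    (v : TangentSpace I p) :
    mvfderiv I (fun q ↦ χ (f q)) p v = deriv χ (f p) * mvfderiv I f p v := by
  have hcomp := congrArg (fun A : E →L[ℝ] ℝ ↦ A v)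
    (hχ.hasDerivAt.hasFDerivAt.hasMFDerivAt.comp p hf.hasMFDerivAt).mfderiv
  exact hcomp.trans (mul_comm _ _)

lemma mvfderiv_div (hf : MDiffAt f p) (hu : MDiffAt u p) (hu0 : u p ≠ 0)
    (v : TangentSpace I p) :
    mvfderiv I (fun q ↦ f q / u q) p v =
      (mvfderiv I f p v - f p / u p * mvfderiv I u p v) / u p := by
  have hinv := mvfderiv_real_comp (hasDerivAt_inv hu0).differentiableAt hu v
  have hu_inv : MDiffAt (fun q ↦ (u q)⁻¹) p :=
    ((hasDerivAt_inv hu0).differentiableAt.mdifferentiableAt).comp p hu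
  simp only [div_eq_mul_inv]
  rw [mvfderiv_fun_mul hf hu_inv, add_apply, smul_apply, smul_apply, hinv,
    (hasDerivAt_inv hu0).deriv, smul_eq_mul, smul_eq_mul]
  field_simp
  ring

/-- A smooth function `f` is `V`-linear of slope `a` if `V f = a f`. -/
structure HasSlope (V : Π p : M, TangentSpace I p) (a : ℝ) (f : M → ℝ) : Prop where
  smooth : ContMDiff I 𝓘(ℝ) ∞ f
  mvfderiv_apply : ∀ p, mvfderiv I f p (V p) = a * f p

lemma HasSlope.mdifferentiableAt (hf : HasSlope V a f) : MDiffAt f p :=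
  hf.smooth.mdifferentiableAt (by simp)

lemma IsPositiveLinear.hasSlope (hf : IsPositiveLinear V f) : HasSlope V 1 f :=
  ⟨hf.smooth, fun p ↦ by rw [hf.linear, one_mul]⟩

lemma hasSlope_zero_const (c : ℝ) : HasSlope V 0 (fun _ ↦ c) where
  smooth := contMDiff_const
  mvfderiv_apply p := by rw [mvfderiv_const, zero_apply, zero_mul]

lemma HasSlope.sub (hf : HasSlope V a f) (hu : HasSlope V a u) :
    HasSlope V a (fun p ↦ f p - u p) where
  smooth := hf.smooth.sub hu.smooth
  mvfderiv_apply p := by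
    rw [mvfderiv_fun_sub hf.mdifferentiableAt hu.mdifferentiableAt, sub_apply,
      hf.mvfderiv_apply, hu.mvfderiv_apply, mul_sub]

lemma HasSlope.mul (hf : HasSlope V a f) (hu : HasSlope V b u) :
    HasSlope V (a + b) (fun p ↦ f p * u p) where
  smooth := hf.smooth.mul hu.smooth
  mvfderiv_apply p := by
    rw [mvfderiv_fun_mul hf.mdifferentiableAt hu.mdifferentiableAt, add_apply, smul_apply,
      smul_apply, hf.mvfderiv_apply, hu.mvfderiv_apply, smul_eq_mul, smul_eq_mul]
    ring

lemma HasSlope.div (hf : HasSlope V a f) (hu : HasSlope V b u) (hu0 : ∀ p, u p ≠ 0) :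
    HasSlope V (a - b) (fun p ↦ f p / u p) where
  smooth := hf.smooth.div₀ hu.smooth hu0
  mvfderiv_apply p := by
    rw [mvfderiv_div hf.mdifferentiableAt hu.mdifferentiableAt (hu0 p), hf.mvfderiv_apply,
      hu.mvfderiv_apply]
    field_simp [hu0 p]

end Slope

section EulerField

variable {E : Type*} [NormedAddCommGroup E] [NormedSpace ℝ E] [FiniteDimensional ℝ E]
  {H : Type*} [TopologicalSpace H] {I : ModelWithCorners ℝ E H}
  {M : Type*} [TopologicalSpace M] [ChartedSpace H M] [IsManifold I ∞ M]
  {g : SmoothMetric I M} {V : Π p : M, TangentSpace I p} {f u : M → ℝ} {a b : ℝ} {p : M}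

lemma leviCivita_eq_smul_of_isLinearMetric (hV : MDiffAt (T% V) p) (hg : IsLinearMetric g V a)
    (hsa : IsSelfAdjointFor g (leviCivita g V)) (v : TangentSpace I p) :
    leviCivita g V p v = (a / 2) • v := by
  refine ext_inner g p fun w ↦ ?_
  obtain ⟨X, hX, rfl⟩ := exists_ext v
  obtain ⟨Y, hY, rfl⟩ := exists_ext w
  have hlie := hg X Y p hX hY
  rw [lieDerivMetric, ← leviCivita_sub_leviCivita g hV hX, ← leviCivita_sub_leviCivita g hV hY,
    leviCivita_metric g hV hX hY] at hlie
  have hsymm := hsa p (X p) (Y p)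
  simp only [map_sub, sub_apply, map_smul, smul_apply, smul_eq_mul] at hlie ⊢
  linarith

variable (g V) in
/-- A smooth vector field `V` with `∇V = 1/2`. It is half the radial field of a metric cone, so
that functions of slope `1` are homogeneous of degree `2`. -/
structure IsEulerField : Prop where
  smooth : ContMDiff I (I.prod 𝓘(ℝ, E)) ∞ (T% V)
  leviCivita_apply : ∀ (p : M) (v : TangentSpace I p), leviCivita g V p v = (1 / 2 : ℝ) • v

lemma IsLinearMetric.isEulerField (hg : IsLinearMetric g V 1)
    (hV : ContMDiff I (I.prod 𝓘(ℝ, E)) ∞ (T% V))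
    (hsa : IsSelfAdjointFor g (leviCivita g V)) : IsEulerField g V :=
  ⟨hV, fun _ v ↦ leviCivita_eq_smul_of_isLinearMetric
    (hV.mdifferentiableAt (by simp)) hg hsa v⟩

lemma IsEulerField.mdifferentiableAt (hV : IsEulerField g V) : MDiffAt (T% V) p :=
  hV.smooth.mdifferentiableAt (by simp)

lemma IsEulerField.divergence_eq (hV : IsEulerField g V) (p : M) :
    divergence g V p = (Module.finrank ℝ E : ℝ) / 2 := by
  have hhalf : (leviCivita g V p : TangentSpace I p →ₗ[ℝ] TangentSpace I p) =
      (1 / 2 : ℝ) • LinearMap.id := LinearMap.ext (hV.leviCivita_apply p)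
  rw [divergence, hhalf, map_smul, smul_eq_mul, one_div_mul_eq_div]
  exact congrArg (· / 2) (LinearMap.trace_id ℝ E)

section Boundaryless

variable [I.Boundaryless]

lemma inner_hess_self_le (hf : ContMDiff I 𝓘(ℝ) ∞ f) (hpsd : HasPosSemidefHessian g f)
    (v : TangentSpace I p) :
    g.inner p (hess g f p v) (hess g f p v) ≤
      laplacian g f p * g.inner p (hess g f p v) v := by
  let : RiemannianBundle (TangentSpace I : M → Type _) := ⟨g.toRiemannianMetric⟩
  have : FiniteDimensional ℝ (TangentSpace I p) := inferInstanceAs (FiniteDimensional ℝ E)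
  have hpos : (hess g f p).toLinearMap.IsPositive := ⟨hess_symm g hf, hpsd p⟩
  have h := norm_apply_sq_le_trace_mul_inner hpos v
  rw [← real_inner_self_eq_norm_sq] at h
  exact h

lemma laplacian_nonneg (hf : ContMDiff I 𝓘(ℝ) ∞ f) (hpsd : HasPosSemidefHessian g f) (p : M) :
    0 ≤ laplacian g f p := by
  let : RiemannianBundle (TangentSpace I : M → Type _) := ⟨g.toRiemannianMetric⟩
  have : FiniteDimensional ℝ (TangentSpace I p) := inferInstanceAs (FiniteDimensional ℝ E)
  have hpos : (hess g f p).toLinearMap.IsPositive := ⟨hess_symm g hf, hpsd p⟩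
  exact hpos.trace_nonneg

/-- The Leibniz rule for `⟨∇f, V⟩ = a f`, with `∇V = 1/2`. -/
lemma IsEulerField.hess_apply (hV : IsEulerField g V) (hf : HasSlope V a f) (p : M) :
    hess g f p (V p) = (a - 1 / 2) • grad g f p := by
  refine ext_inner g p fun w ↦ ?_
  obtain ⟨X, hX, rfl⟩ := exists_ext w
  have hVf : (fun q ↦ mvfderiv I f q (V q)) = fun q ↦ a * f q := funext hf.mvfderiv_apply
  rw [hess_symm g hf.smooth, g.symm, inner_hess g hf.smooth hX hV.mdifferentiableAt, hVf,
    hV.leviCivita_apply, mvfderiv_fun_mul mdifferentiableAt_const hf.mdifferentiableAt,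
    mvfderiv_const]
  simp only [smul_zero, add_zero, map_smul, smul_apply, smul_eq_mul, inner_grad]
  ring

lemma HasSlope.pairing_grad (hV : IsEulerField g V) (hf : HasSlope V a f)
    (hu : HasSlope V b u) :
    HasSlope V (a + b - 1) (pairing g (grad g f) (grad g u)) where
  smooth := contMDiff_pairing_grad g hf.smooth hu.smooth
  mvfderiv_apply p := by
    rw [leviCivita_metric g hV.mdifferentiableAt (mdifferentiableAt_grad g hf.smooth)
      (mdifferentiableAt_grad g hu.smooth), ← hess, ← hess, hV.hess_apply hf, hV.hess_apply hu,
      pairing]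
    simp only [map_smul, smul_apply, smul_eq_mul]
    ring

lemma IsPositiveLinear.pairing_grad_self_le (hV : IsEulerField g V) (hf : IsPositiveLinear V f)
    (hpsd : HasPosSemidefHessian g f) (p : M) :
    pairing g (grad g f) (grad g f) p ≤ 2 * f p * laplacian g f p := by
  have htrace := inner_hess_self_le hf.smooth hpsd (V p)
  have hgradV : g.inner p (grad g f p) (V p) = f p := (inner_grad g f _).trans (hf.linear p)
  rw [hV.hess_apply hf.hasSlope] at htrace
  simp only [map_smul, smul_apply, smul_eq_mul, hgradV] at htrace
  rw [pairing]
  linarith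

end Boundaryless

end EulerField

section Proper

/-- Properness of `F` as a map to `(0, ∞)`. -/
def IsProperOnPos {X : Type*} [TopologicalSpace X] (F : X → ℝ) : Prop :=
  ∀ K : Set ℝ, IsCompact K → K ⊆ Set.Ioi 0 → IsCompact (F ⁻¹' K)

lemma exists_subset_Icc_of_subset_Ioi {K : Set ℝ} {c : ℝ} (hK : IsCompact K)
    (hKc : K ⊆ Set.Ioi c) : ∃ a b, c < a ∧ K ⊆ Set.Icc a b := by
  obtain rfl | hne := K.eq_empty_or_nonempty
  · exact ⟨c + 1, c, by linarith, Set.empty_subset _⟩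
  · exact ⟨sInf K, sSup K, hKc (hK.sInf_mem hne), hK.isBounded.subset_Icc_sInf_sSup⟩

variable {X : Type*} [TopologicalSpace X] {F G : X → ℝ} {L : ℝ}

lemma IsProperOnPos.exists_isCompact (hG : IsProperOnPos G) {K : Set ℝ} (hK : IsCompact K)
    (hK0 : K ⊆ Set.Ioi 0) (hL : 0 < L) :
    ∃ C, IsCompact C ∧
      ∀ F : X → ℝ, (∀ x, G x ≤ F x) → (∀ x, F x ≤ L * G x) → F ⁻¹' K ⊆ C := by
  obtain ⟨a, b, ha, hKab⟩ := exists_subset_Icc_of_subset_Ioi hK hK0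
  refine ⟨G ⁻¹' Set.Icc (a / L) b, hG _ isCompact_Icc fun s hs ↦ ?_, fun F hGF hFG x hx ↦ ?_⟩
  · exact (div_pos ha hL).trans_le hs.1
  · have hFx := hKab hx
    exact ⟨(div_le_iff₀' hL).2 (hFx.1.trans (hFG x)), (hGF x).trans hFx.2⟩

lemma IsProperOnPos.of_le_of_le_mul (hG : IsProperOnPos G) (hF : Continuous F) (hL : 0 < L)
    (hGF : ∀ x, G x ≤ F x) (hFG : ∀ x, F x ≤ L * G x) : IsProperOnPos F := fun _ hK hK0 ↦
  have ⟨_, hC, hCF⟩ := hG.exists_isCompact hK hK0 hL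
  hC.of_isClosed_subset (hK.isClosed.preimage hF) (hCF F hGF hFG)

/-- The map `(s, y) ↦ Φ (s - log F (Φ (0, y)), y)` trivializes `F` to `exp s`. -/
lemma isProperOnPos_of_exp_mul {Y : Type*} [TopologicalSpace Y] [CompactSpace Y] {Φ : ℝ × Y → X}
    (hΦ : Continuous Φ) (hsurj : Φ.Surjective) (hF : Continuous F) (hF0 : ∀ x, 0 < F x)
    (hexp : ∀ t y, F (Φ (t, y)) = Real.exp t * F (Φ (0, y))) : IsProperOnPos F := by
  intro K hK hK0
  have hlog : Continuous fun y ↦ Real.log (F (Φ (0, y))) :=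
    (hF.comp (hΦ.comp (by fun_prop))).log fun y ↦ (hF0 _).ne'
  have hΨ : Continuous fun q : ℝ × Y ↦ Φ (q.1 - Real.log (F (Φ (0, q.2))), q.2) :=
    hΦ.comp ((continuous_fst.sub (hlog.comp continuous_snd)).prodMk continuous_snd)
  have hlogK : IsCompact (Real.log '' K) := hK.image_of_continuousOn <|
    Real.continuousOn_log.mono fun s hs ↦ (hK0 hs).ne'
  refine ((hlogK.prod isCompact_univ).image hΨ).of_isClosed_subset (hK.isClosed.preimage hF)
    fun x hx ↦ ?_
  obtain ⟨⟨t, y⟩, rfl⟩ := hsurj x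
  refine ⟨(Real.log (F (Φ (t, y))), y), ⟨⟨_, hx, rfl⟩, Set.mem_univ y⟩, ?_⟩
  simp only [hexp t y, Real.log_mul (Real.exp_ne_zero t) (hF0 _).ne', Real.log_exp,
    add_sub_cancel_right]

end Proper

section Flow

lemma HasSlope.comp_integralCurve {E : Type*} [NormedAddCommGroup E] [NormedSpace ℝ E]
    {H : Type*} [TopologicalSpace H] {I : ModelWithCorners ℝ E H}
    {M : Type*} [TopologicalSpace M] [ChartedSpace H M] {V : Π p : M, TangentSpace I p}
    {f : M → ℝ} {a : ℝ} (hf : HasSlope V a f) {γ : ℝ → M} (hγ : IsMIntegralCurve γ V) (t : ℝ) :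
    f (γ t) = Real.exp (a * t) * f (γ 0) := by
  have hderiv (t : ℝ) : HasDerivAt (fun t ↦ f (γ t)) (a * f (γ t)) t := by
    have hcomp : HasFDerivAt (fun t ↦ f (γ t))
        ((mvfderiv I f (γ t)).comp ((1 : ℝ →L[ℝ] ℝ).smulRight (V (γ t)))) t :=
      (hf.mdifferentiableAt.hasMFDerivAt.comp t (hγ t)).hasFDerivAt
    refine hcomp.hasDerivAt.congr_deriv ?_
    rw [← hf.mvfderiv_apply]
    exact congrArg (mvfderiv I f (γ t)) (one_smul ℝ (V (γ t)))
  have hconst (t : ℝ) : HasDerivAt (fun t ↦ Real.exp (-(a * t)) * f (γ t)) 0 t :=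
    ((((hasDerivAt_id t).const_mul a).neg.exp).mul (hderiv t)).congr_deriv (by simp; ring)
  have heq := is_const_of_deriv_eq_zero (fun t ↦ (hconst t).differentiableAt)
    (fun t ↦ (hconst t).deriv) t 0
  simp only [mul_zero, neg_zero, Real.exp_zero, one_mul] at heq
  rw [← heq, ← mul_assoc, ← Real.exp_add, add_neg_cancel, Real.exp_zero, one_mul]

lemma IsCylindrical.isProperOnPos {d m : ℕ}
    {M : Type*} [TopologicalSpace M] [ChartedSpace (EuclideanSpace ℝ (Fin d)) M]
    {Y : Type*} [TopologicalSpace Y] [CompactSpace Y] [ChartedSpace (EuclideanSpace ℝ (Fin m)) Y]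
    {V : Π p : M, TangentSpace (𝓡 d) p} {ι : Y → M} {F : M → ℝ} (hV : IsCylindrical m V ι)
    (hF : IsPositiveLinear V F) : IsProperOnPos F := by
  obtain ⟨Φ, hΦ⟩ := hV.flow
  refine isProperOnPos_of_exp_mul Φ.continuous Φ.surjective hF.smooth.continuous hF.pos
    fun t y ↦ ?_
  rw [hF.hasSlope.comp_integralCurve (hΦ y).2 t, one_mul]

end Flow

section Cutoff

/-- A test function on `(0, ∞)`, extended by zero to `ℝ`. -/
structure IsCutoff (χ : ℝ → ℝ) : Prop where
  contDiff : ContDiff ℝ ∞ χ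
  hasCompactSupport : HasCompactSupport χ
  tsupport_subset : tsupport χ ⊆ Set.Ioi 0

variable {χ : ℝ → ℝ}

lemma IsCutoff.deriv (hχ : IsCutoff χ) : IsCutoff (deriv χ) where
  contDiff := (contDiff_infty_iff_deriv.1 hχ.contDiff).2
  hasCompactSupport := hχ.hasCompactSupport.deriv
  tsupport_subset := (closure_minimal support_deriv_subset isClosed_closure).trans
    hχ.tsupport_subset

variable {X : Type*} [TopologicalSpace X] {F φ : X → ℝ}

lemma IsCutoff.hasCompactSupport_comp (hχ : IsCutoff χ) (hF : IsProperOnPos F)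
    (hFc : Continuous F) : HasCompactSupport (fun x ↦ χ (F x)) :=
  HasCompactSupport.intro' (hF _ hχ.hasCompactSupport hχ.tsupport_subset)
    (hχ.hasCompactSupport.isClosed.preimage hFc) fun _ hx ↦ image_eq_zero_of_notMem_tsupport hx

lemma IsCutoff.integrable [MeasurableSpace X] [OpensMeasurableSpace X] {μ : Measure X}
    [IsFiniteMeasureOnCompacts μ] (hχ : IsCutoff χ) (hF : IsProperOnPos F)
    (hFc : Continuous F) (hφ : Continuous φ) : Integrable (fun x ↦ χ (F x) * φ x) μ :=
  ((hχ.contDiff.continuous.comp hFc).mul hφ).integrable_of_hasCompactSupport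
    (hχ.hasCompactSupport_comp hF hFc).mul_right

end Cutoff

section LogPairing

variable {E : Type*} [NormedAddCommGroup E] [NormedSpace ℝ E] [FiniteDimensional ℝ E]
  {H : Type*} [TopologicalSpace H] {I : ModelWithCorners ℝ E H}
  {M : Type*} [TopologicalSpace M] [ChartedSpace H M] [IsManifold I ∞ M]
  {g : SmoothMetric I M} {V : Π p : M, TangentSpace I p} {F u : M → ℝ} {a b : ℝ}

variable (g F u) in
/-- The pairing `⟨∇ log F, ∇u⟩`. -/
noncomputable def logPairing (p : M) : ℝ := pairing g (grad g F) (grad g u) p / F p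

lemma logPairing_self_nonneg {p : M} (hF0 : 0 ≤ F p) : 0 ≤ logPairing g F F p := by
  refine div_nonneg ?_ hF0
  obtain h0 | h0 := eq_or_ne (grad g F p) 0
  · rw [pairing, h0, map_zero]
  · exact (g.pos p _ h0).le

lemma HasSlope.logPairing [I.Boundaryless] (hV : IsEulerField g V) (hF : HasSlope V b F)
    (hF0 : ∀ p, F p ≠ 0) (hu : HasSlope V a u) : HasSlope V (a - 1) (logPairing g F u) := by
  have hdiv := (HasSlope.pairing_grad hV hF hu).div hF hF0
  rwa [show b + a - 1 - b = a - 1 by ring] at hdiv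

lemma pairing_grad_div {p : M} (hu : MDiffAt u p) (hF : MDiffAt F p) (hF0 : F p ≠ 0) :
    pairing g (grad g F) (grad g fun q ↦ u q / F q) p =
      logPairing g F u p - u p / F p * logPairing g F F p := by
  simp only [logPairing, pairing_comm g (grad g F)]
  simp only [pairing, inner_grad, mvfderiv_div hu hF hF0]
  field_simp

end LogPairing

section IntegrationByParts

variable {d : ℕ} {M : Type*} [TopologicalSpace M] [ChartedSpace (EuclideanSpace ℝ (Fin d)) M]
  [IsManifold (𝓡 d) ∞ M] {g : SmoothMetric (𝓡 d) M} {V X : Π p : M, TangentSpace (𝓡 d) p}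
  {F h w : M → ℝ} {χ : ℝ → ℝ}

lemma continuous_laplacian (hF : ContMDiff (𝓡 d) 𝓘(ℝ) ∞ F) : Continuous (laplacian g F) :=
  continuous_divergence g (contMDiff_grad g hF)

variable (g) [T2Space M] [SigmaCompactSpace M] [MeasurableSpace M] [BorelSpace M]

lemma integral_mul_divergence_add_mvfderiv (hh : ContMDiff (𝓡 d) 𝓘(ℝ) ∞ h)
    (hh_supp : HasCompactSupport h)
    (hX : ContMDiff (𝓡 d) ((𝓡 d).prod 𝓘(ℝ, EuclideanSpace ℝ (Fin d))) ∞ (T% X)) :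
    ∫ p, (h p * divergence g X p + mvfderiv (𝓡 d) h p (X p)) ∂(riemannianVolume g) = 0 := by
  have hzero := integral_divergence_eq_zero g (X := h • X) (hh.smul_section hX) hh_supp
    fun p hp ↦ by simp only [Pi.smul_apply', image_eq_zero_of_notMem_tsupport hp, zero_smul]
  rw [← hzero]
  exact integral_congr_ae <| .of_forall fun p ↦
    (divergence_smul g (hX.mdifferentiableAt (by simp)) (hh.mdifferentiableAt (by simp))).symm

/-- The divergence theorem for `χ(F) w X`. -/
lemma integral_cutoff_mul_divergence (hχ : IsCutoff χ) (hF : ContMDiff (𝓡 d) 𝓘(ℝ) ∞ F)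
    (hFp : IsProperOnPos F) (hw : ContMDiff (𝓡 d) 𝓘(ℝ) ∞ w)
    (hX : ContMDiff (𝓡 d) ((𝓡 d).prod 𝓘(ℝ, EuclideanSpace ℝ (Fin d))) ∞ (T% X)) :
    ∫ p, χ (F p) * (w p * divergence g X p) ∂(riemannianVolume g) =
      -(∫ p, deriv χ (F p) * (pairing g (grad g F) X p * w p) ∂(riemannianVolume g)) -
        ∫ p, χ (F p) * pairing g (grad g w) X p ∂(riemannianVolume g) := by
  have hχF : ContMDiff (𝓡 d) 𝓘(ℝ) ∞ (fun p ↦ χ (F p)) := hχ.contDiff.contMDiff.comp hF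
  have hpairing {f : M → ℝ} (hf : ContMDiff (𝓡 d) 𝓘(ℝ) ∞ f) :
      Continuous (pairing g (grad g f) X) := continuous_iff_continuousAt.2 fun p ↦
    (contMDiffAt_pairing (n := ⊤) g (contMDiff_grad g hf p) (hX p)).continuousAt
  have hleibniz (p : M) : χ (F p) * w p * divergence g X p +
      mvfderiv (𝓡 d) (fun q ↦ χ (F q) * w q) p (X p) =
      χ (F p) * (w p * divergence g X p) + deriv χ (F p) * (pairing g (grad g F) X p * w p) +
        χ (F p) * pairing g (grad g w) X p := by
    rw [mvfderiv_fun_mul (hχF.mdifferentiableAt (by simp)) (hw.mdifferentiableAt (by simp)),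
      add_apply, smul_apply, smul_apply, mvfderiv_real_comp
        (hχ.contDiff.differentiable (by simp) _) (hF.mdifferentiableAt (by simp)), pairing,
      pairing, inner_grad, inner_grad, smul_eq_mul, smul_eq_mul]
    ring
  have hzero := integral_mul_divergence_add_mvfderiv g (h := fun p ↦ χ (F p) * w p) (hχF.mul hw)
    (hχ.hasCompactSupport_comp hFp hF.continuous).mul_right hX
  have hdiv : Integrable (fun p ↦ χ (F p) * (w p * divergence g X p)) (riemannianVolume g) :=
    hχ.integrable hFp hF.continuous (hw.continuous.mul (continuous_divergence g hX))
  have hdF : Integrable (fun p ↦ deriv χ (F p) * (pairing g (grad g F) X p * w p))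
      (riemannianVolume g) :=
    hχ.deriv.integrable hFp hF.continuous ((hpairing hF).mul hw.continuous)
  have hdw : Integrable (fun p ↦ χ (F p) * pairing g (grad g w) X p) (riemannianVolume g) :=
    hχ.integrable hFp hF.continuous (hpairing hw)
  rw [integral_congr_ae (.of_forall hleibniz), integral_add (by exact hdiv.add hdF) hdw,
    integral_add hdiv hdF] at hzero
  linarith

variable {g}

lemma IsEulerField.integral_deriv_cutoff_mul (hV : IsEulerField g V) (hχ : IsCutoff χ)
    (hF : HasSlope V 1 F) (hFp : IsProperOnPos F) (hw : HasSlope V 0 w) :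
    ∫ p, deriv χ (F p) * (F p * w p) ∂(riemannianVolume g) =
      -(d / 2 : ℝ) * ∫ p, χ (F p) * w p ∂(riemannianVolume g) := by
  have hparts := integral_cutoff_mul_divergence g hχ hF.smooth hFp hw.smooth hV.smooth
  simp only [hV.divergence_eq, finrank_euclideanSpace_fin, pairing, inner_grad,
    hF.mvfderiv_apply, hw.mvfderiv_apply, one_mul, zero_mul, mul_zero, integral_zero,
    sub_zero, ← mul_assoc, integral_mul_const] at hparts ⊢
  linarith

lemma IsEulerField.integral_cutoff_mul_laplacian (hV : IsEulerField g V) (hχ : IsCutoff χ)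
    (hF : IsPositiveLinear V F) (hFp : IsProperOnPos F) (hw : HasSlope V 0 w) :
    ∫ p, χ (F p) * (w p * laplacian g F p) ∂(riemannianVolume g) =
      d / 2 * ∫ p, χ (F p) * (w p * logPairing g F F p) ∂(riemannianVolume g) -
        ∫ p, χ (F p) * pairing g (grad g F) (grad g w) p ∂(riemannianVolume g) := by
  have hPw : HasSlope V 0 (fun p ↦ w p * logPairing g F F p) := by
    simpa using hw.mul (hF.hasSlope.logPairing hV (fun p ↦ (hF.pos p).ne') hF.hasSlope)
  have hscale := hV.integral_deriv_cutoff_mul hχ hF.hasSlope hFp hPw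
  have hPF (p : M) : F p * (w p * logPairing g F F p) =
      pairing g (grad g F) (grad g F) p * w p := by
    rw [logPairing]
    field_simp [(hF.pos p).ne']
  have hparts := integral_cutoff_mul_divergence g hχ hF.smooth hFp hw.smooth
    (contMDiff_grad g hF.smooth)
  simp only [hPF] at hscale
  rw [hscale, pairing_comm g (grad g w)] at hparts
  simp only [laplacian_eq_divergence]
  rw [hparts]
  ring

lemma IsEulerField.integral_cutoff_laplacian (hV : IsEulerField g V) (hχ : IsCutoff χ)
    (hF : IsPositiveLinear V F) (hFp : IsProperOnPos F) :
    ∫ p, χ (F p) * laplacian g F p ∂(riemannianVolume g) =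
      d / 2 * ∫ p, χ (F p) * logPairing g F F p ∂(riemannianVolume g) := by
  have hconst : pairing g (grad g F) (grad g fun _ ↦ 1) = 0 := funext fun p ↦ by
    rw [pairing_comm, pairing, inner_grad, mvfderiv_const, zero_apply, Pi.zero_apply]
  simpa [hconst] using hV.integral_cutoff_mul_laplacian hχ hF hFp (hasSlope_zero_const 1)

end IntegrationByParts

section Linearity

variable {E : Type*} [NormedAddCommGroup E] [NormedSpace ℝ E] [FiniteDimensional ℝ E]
  {H : Type*} [TopologicalSpace H] {I : ModelWithCorners ℝ E H}
  {M : Type*} [TopologicalSpace M] [ChartedSpace H M] [IsManifold I ∞ M]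
  (g : SmoothMetric I M) {V : Π p : M, TangentSpace I p} {f u : M → ℝ} {c : ℝ} {p : M}

lemma grad_add (hf : MDiffAt f p) (hu : MDiffAt u p) :
    grad g (fun q ↦ f q + u q) p = grad g f p + grad g u p :=
  ext_inner g p fun w ↦ by
    simp only [map_add, add_apply, inner_grad, mvfderiv_fun_add hf hu]

lemma grad_const_mul (c : ℝ) (hf : MDiffAt f p) :
    grad g (fun q ↦ c * f q) p = c • grad g f p :=
  ext_inner g p fun w ↦ by
    simp only [map_smul, smul_apply, inner_grad, mvfderiv_fun_mul mdifferentiableAt_const hf,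
      mvfderiv_const, smul_zero, add_zero]

variable [I.Boundaryless]

lemma hess_add (hf : ContMDiff I 𝓘(ℝ) ∞ f) (hu : ContMDiff I 𝓘(ℝ) ∞ u) (p : M) :
    hess g (fun q ↦ f q + u q) p = hess g f p + hess g u p := by
  have hgrad : grad g (fun q ↦ f q + u q) = grad g f + grad g u := funext fun _ ↦
    grad_add g (hf.mdifferentiableAt (by simp)) (hu.mdifferentiableAt (by simp))
  rw [hess, hgrad]
  exact (leviCivita g).isCovariantDerivativeOnUniv.add (mdifferentiableAt_grad g hf)
    (mdifferentiableAt_grad g hu)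

lemma hess_const_mul (c : ℝ) (hf : ContMDiff I 𝓘(ℝ) ∞ f) (p : M) :
    hess g (fun q ↦ c * f q) p = c • hess g f p := by
  have hgrad : grad g (fun q ↦ c * f q) = (fun _ : M ↦ c) • grad g f := funext fun _ ↦
    grad_const_mul g c (hf.mdifferentiableAt (by simp))
  rw [hess, hgrad]
  refine ((leviCivita g).isCovariantDerivativeOnUniv.leibniz (mdifferentiableAt_grad g hf)
    mdifferentiableAt_const).trans ?_
  rw [mvfderiv_const]
  ext v
  simp [hess]

variable {g}

lemma HasPosSemidefHessian.add (hfp : HasPosSemidefHessian g f) (hup : HasPosSemidefHessian g u)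
    (hf : ContMDiff I 𝓘(ℝ) ∞ f) (hu : ContMDiff I 𝓘(ℝ) ∞ u) :
    HasPosSemidefHessian g (fun q ↦ f q + u q) := fun p v ↦ by
  rw [hess_add g hf hu, add_apply, map_add, add_apply]
  exact add_nonneg (hfp p v) (hup p v)

lemma HasPosSemidefHessian.const_mul (hfp : HasPosSemidefHessian g f) (hc : 0 ≤ c)
    (hf : ContMDiff I 𝓘(ℝ) ∞ f) : HasPosSemidefHessian g (fun q ↦ c * f q) := fun p v ↦ by
  rw [hess_const_mul g c hf, smul_apply, map_smul, smul_apply]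
  exact mul_nonneg hc (hfp p v)

end Linearity

section FirstVariation

variable {E : Type*} [NormedAddCommGroup E] [NormedSpace ℝ E] [FiniteDimensional ℝ E]
  {H : Type*} [TopologicalSpace H] {I : ModelWithCorners ℝ E H}
  {M : Type*} [TopologicalSpace M] [ChartedSpace H M] [IsManifold I ∞ M]
  (g : SmoothMetric I M) {F G u : M → ℝ} {p : M}

/-- The first variation of `χ(F) ⟨∇ log F, ∇F⟩` in the direction `u`. -/
noncomputable def firstVariation (χ : ℝ → ℝ) (F u : M → ℝ) (p : M) : ℝ :=
  deriv χ (F p) * (u p * logPairing g F F p) +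
    χ (F p) * (2 * logPairing g F u p - u p / F p * logPairing g F F p)

lemma logPairing_add_const_mul_left (hG : MDiffAt G p) (hu : MDiffAt u p) (t : ℝ) :
    logPairing g (fun q ↦ G q + t * u q) u p =
      (pairing g (grad g G) (grad g u) p + t * pairing g (grad g u) (grad g u) p) /
        (G p + t * u p) := by
  simp only [logPairing, pairing,
    grad_add g hG (u := fun q ↦ t * u q) (mdifferentiableAt_const.mul hu), grad_const_mul g t hu,
    map_add, map_smul, add_apply, smul_apply, smul_eq_mul]

lemma logPairing_add_const_mul_self (hG : MDiffAt G p) (hu : MDiffAt u p) (t : ℝ) :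
    logPairing g (fun q ↦ G q + t * u q) (fun q ↦ G q + t * u q) p =
      (pairing g (grad g G) (grad g G) p + 2 * t * pairing g (grad g G) (grad g u) p +
        t ^ 2 * pairing g (grad g u) (grad g u) p) / (G p + t * u p) := by
  simp only [logPairing, pairing,
    grad_add g hG (u := fun q ↦ t * u q) (mdifferentiableAt_const.mul hu), grad_const_mul g t hu,
    map_add, map_smul, add_apply, smul_apply, smul_eq_mul, g.symm p (grad g u p) (grad g G p)]
  ring

lemma hasDerivAt_cutoff_mul_logPairing {χ : ℝ → ℝ} {t : ℝ} (hG : MDiffAt G p) (hu : MDiffAt u p)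
    (hχ : Differentiable ℝ χ) (h0 : G p + t * u p ≠ 0) :
    HasDerivAt (fun s ↦ χ (G p + s * u p) *
        logPairing g (fun q ↦ G q + s * u q) (fun q ↦ G q + s * u q) p)
      (firstVariation g χ (fun q ↦ G q + t * u q) u p) t := by
  have hline : HasDerivAt (fun s ↦ G p + s * u p) (u p) t := by
    simpa using ((hasDerivAt_id t).mul_const (u p)).const_add (G p)
  have hχline := (hχ _).hasDerivAt.comp t hline
  have hsquare : HasDerivAt (fun s ↦ pairing g (grad g G) (grad g G) p +
      2 * s * pairing g (grad g G) (grad g u) p + s ^ 2 * pairing g (grad g u) (grad g u) p)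
      (2 * pairing g (grad g G) (grad g u) p + 2 * t * pairing g (grad g u) (grad g u) p) t := by
    simpa using ((((hasDerivAt_id t).const_mul 2).mul_const
      (pairing g (grad g G) (grad g u) p)).const_add _).fun_add
      (((hasDerivAt_id t).pow 2).mul_const (pairing g (grad g u) (grad g u) p))
  simp only [firstVariation, logPairing_add_const_mul_self g hG hu,
    logPairing_add_const_mul_left g hG hu]
  refine (hχline.mul (hsquare.fun_div hline h0)).congr_deriv ?_
  simp only [Function.comp_apply]
  field_simp

end FirstVariation

section DifferentialInequality

variable {d : ℕ} {M : Type*} [TopologicalSpace M] [ChartedSpace (EuclideanSpace ℝ (Fin d)) M]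
  [IsManifold (𝓡 d) ∞ M] [T2Space M] [SigmaCompactSpace M] [MeasurableSpace M] [BorelSpace M]
  {g : SmoothMetric (𝓡 d) M} {V : Π p : M, TangentSpace (𝓡 d) p} {F u : M → ℝ} {χ : ℝ → ℝ}
  {c : ℝ}

/-- Scaling along `V` eliminates `χ'`, and integrating `(u / F) ΔF` by parts
eliminates `⟨∇ log F, ∇u⟩`. -/
lemma IsEulerField.integral_firstVariation (hV : IsEulerField g V) (hχ : IsCutoff χ)
    (hF : IsPositiveLinear V F) (hFp : IsProperOnPos F) (hu : HasSlope V 1 u) :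
    ∫ p, firstVariation g χ F u p ∂(riemannianVolume g) =
      (d / 2 + 1) * ∫ p, χ (F p) * (u p / F p * logPairing g F F p) ∂(riemannianVolume g) -
        2 * ∫ p, χ (F p) * (u p / F p * laplacian g F p) ∂(riemannianVolume g) := by
  have hF0 (p : M) : F p ≠ 0 := (hF.pos p).ne'
  have hq : HasSlope V 0 (fun p ↦ u p / F p) := by simpa using hu.div hF.hasSlope hF0
  have hP : HasSlope V 0 (logPairing g F F) := by
    simpa using hF.hasSlope.logPairing hV hF0 hF.hasSlope
  have hQ : HasSlope V 0 (logPairing g F u) := by simpa using hF.hasSlope.logPairing hV hF0 hu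
  have hqP : HasSlope V 0 (fun p ↦ u p / F p * logPairing g F F p) := by simpa using hq.mul hP
  have hint {χ : ℝ → ℝ} (hχ : IsCutoff χ) {φ : M → ℝ} (hφ : Continuous φ) :
      Integrable (fun p ↦ χ (F p) * φ p) (riemannianVolume g) :=
    hχ.integrable hFp hF.smooth.continuous hφ
  have hscale := hV.integral_deriv_cutoff_mul hχ hF.hasSlope hFp hqP
  have huP (p : M) : F p * (u p / F p * logPairing g F F p) = u p * logPairing g F F p := by
    field_simp [hF0 p]
  have hparts := hV.integral_cutoff_mul_laplacian hχ hF hFp hq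
  simp only [pairing_grad_div hu.mdifferentiableAt hF.hasSlope.mdifferentiableAt (hF0 _), mul_sub]
    at hparts
  rw [integral_sub (hint hχ hQ.smooth.continuous) (hint hχ hqP.smooth.continuous)] at hparts
  simp only [huP] at hscale
  have hsplit : ∫ p, firstVariation g χ F u p ∂(riemannianVolume g) =
      ∫ p, deriv χ (F p) * (u p * logPairing g F F p) ∂(riemannianVolume g) +
        (2 * ∫ p, χ (F p) * logPairing g F u p ∂(riemannianVolume g) -
          ∫ p, χ (F p) * (u p / F p * logPairing g F F p) ∂(riemannianVolume g)) := by
    simp only [firstVariation, mul_sub, mul_left_comm _ (2 : ℝ)]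
    have hQint := (hint hχ hQ.smooth.continuous).const_mul 2
    rw [integral_add (by exact hint hχ.deriv (hu.smooth.continuous.mul hP.smooth.continuous))
      (by exact hQint.sub (hint hχ hqP.smooth.continuous)),
      integral_sub hQint (hint hχ hqP.smooth.continuous), integral_const_mul]
  rw [hsplit, hscale]
  linarith

lemma IsEulerField.integral_firstVariation_le (hV : IsEulerField g V) (hχ : IsCutoff χ)
    (hχ0 : ∀ s, 0 ≤ χ s) (hF : IsPositiveLinear V F) (hFp : IsProperOnPos F)
    (hpsd : HasPosSemidefHessian g F) (hu : HasSlope V 1 u) (hu0 : ∀ p, 0 ≤ u p)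
    (huF : ∀ p, u p ≤ c * F p) :
    ∫ p, firstVariation g χ F u p ∂(riemannianVolume g) ≤
      c * (d : ℝ) ^ 2 / 2 * ∫ p, χ (F p) * logPairing g F F p ∂(riemannianVolume g) := by
  have hF0 (p : M) : F p ≠ 0 := (hF.pos p).ne'
  have hΔ := continuous_laplacian (g := g) hF.smooth
  have hq : Continuous fun p ↦ u p / F p := hu.smooth.continuous.div₀ hF.smooth.continuous hF0
  have hP := (hF.hasSlope.logPairing hV hF0 hF.hasSlope).smooth.continuous
  have hint {φ : M → ℝ} (hφ : Continuous φ) :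
      Integrable (fun p ↦ χ (F p) * φ p) (riemannianVolume g) :=
    hχ.integrable hFp hF.smooth.continuous hφ
  have hgrad_le : ∫ p, χ (F p) * (u p / F p * logPairing g F F p) ∂(riemannianVolume g) ≤
      2 * ∫ p, χ (F p) * (u p / F p * laplacian g F p) ∂(riemannianVolume g) := by
    rw [← integral_const_mul]
    refine integral_mono (hint (hq.mul hP)) ((hint (hq.mul hΔ)).const_mul 2) fun p ↦ ?_
    have hP_le : logPairing g F F p ≤ 2 * laplacian g F p :=
      (div_le_iff₀ (hF.pos p)).2 (by linarith [hF.pairing_grad_self_le hV hpsd p])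
    have hweight : 0 ≤ χ (F p) * (u p / F p) :=
      mul_nonneg (hχ0 _) (div_nonneg (hu0 p) (hF.pos p).le)
    linear_combination mul_le_mul_of_nonneg_left hP_le hweight
  have hratio_le : ∫ p, χ (F p) * (u p / F p * laplacian g F p) ∂(riemannianVolume g) ≤
      c * ∫ p, χ (F p) * laplacian g F p ∂(riemannianVolume g) := by
    rw [← integral_const_mul]
    refine integral_mono (hint (hq.mul hΔ)) ((hint hΔ).const_mul c) fun p ↦ ?_
    have hq_le : u p / F p ≤ c := (div_le_iff₀ (hF.pos p)).2 (huF p)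
    have hweight : 0 ≤ χ (F p) * laplacian g F p :=
      mul_nonneg (hχ0 _) (laplacian_nonneg hF.smooth hpsd p)
    linear_combination mul_le_mul_of_nonneg_right hq_le hweight
  rw [hV.integral_cutoff_laplacian hχ hF hFp] at hratio_le
  rw [hV.integral_firstVariation hχ hF hFp hu]
  linear_combination (d / 2 + 1 : ℝ) * hgrad_le + (d : ℝ) * hratio_le

end DifferentialInequality

section Integral

lemma hasDerivAt_integral_of_compact_support {X : Type*} [TopologicalSpace X] [T2Space X]
    [MeasurableSpace X] [OpensMeasurableSpace X] {μ : Measure X} [IsFiniteMeasureOnCompacts μ]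
    {f f' : ℝ → X → ℝ} {U : Set ℝ} {C : Set X} {t : ℝ} (hU : IsOpen U) (ht : t ∈ U)
    (hC : IsCompact C) (hf : ∀ s ∈ U, Continuous (f s))
    (hf' : ContinuousOn f'.uncurry (U ×ˢ Set.univ))
    (hderiv : ∀ s ∈ U, ∀ x, HasDerivAt (f · x) (f' s x) s)
    (hsupp : ∀ s ∈ U, ∀ x ∉ C, f s x = 0) :
    HasDerivAt (fun s ↦ ∫ x, f s x ∂μ) (∫ x, f' t x ∂μ) t := by
  obtain ⟨K, hK, hKt, hKU⟩ := exists_compact_subset hU ht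
  have hsupp' {s : ℝ} (hs : s ∈ U) {x : X} (hx : x ∉ C) : f' s x = 0 :=
    (hderiv s hs x).unique <| (hasDerivAt_const s 0).congr_of_eventuallyEq <|
      Filter.eventually_of_mem (hU.mem_nhds hs) fun r hr ↦ hsupp r hr x hx
  have hcont' : Continuous (f' t) := hf'.comp_continuous (f := fun x ↦ (t, x)) (by fun_prop)
    fun x ↦ ⟨ht, Set.mem_univ x⟩
  obtain ⟨B, hB⟩ := (hK.prod hC).exists_bound_of_continuousOn
    (hf'.mono (Set.prod_mono hKU C.subset_univ))
  refine (hasDerivAt_integral_of_dominated_loc_of_deriv_le (bound := C.indicator fun _ ↦ B)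
    (mem_interior_iff_mem_nhds.1 hKt)
    (Filter.eventually_of_mem (hU.mem_nhds ht) fun s hs ↦ (hf s hs).aestronglyMeasurable)
    ((hf t ht).integrable_of_hasCompactSupport (.intro hC fun x hx ↦ hsupp t ht x hx))
    hcont'.aestronglyMeasurable (.of_forall fun x s hs ↦ ?_)
    ((integrable_indicator_iff hC.measurableSet).2 (integrableOn_const hC.measure_ne_top))
    (.of_forall fun x s hs ↦ hderiv s (hKU hs) x)).2
  by_cases hx : x ∈ C
  · rw [Set.indicator_of_mem hx]
    exact hB (s, x) ⟨hs, hx⟩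
  · rw [Set.indicator_of_notMem hx, hsupp' (hKU hs) hx, norm_zero]

lemma le_exp_mul_of_deriv_le_mul {f f' : ℝ → ℝ} {a b c : ℝ} (hab : a ≤ b)
    (hf : ContinuousOn f (Set.Icc a b)) (hderiv : ∀ t ∈ Set.Ioo a b, HasDerivAt f (f' t) t)
    (hle : ∀ t ∈ Set.Ioo a b, f' t ≤ c * f t) : f b ≤ Real.exp (c * (b - a)) * f a := by
  have hderiv_exp (t : ℝ) (ht : t ∈ interior (Set.Icc a b)) :
      HasDerivAt (fun t ↦ Real.exp (-(c * t)) * f t)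
        (Real.exp (-(c * t)) * (f' t - c * f t)) t := by
    rw [interior_Icc] at ht
    refine (((hasDerivAt_id t).const_mul c).fun_neg.exp.mul (hderiv t ht)).congr_deriv ?_
    simp only [id_eq]
    ring
  have hanti : AntitoneOn (fun t ↦ Real.exp (-(c * t)) * f t) (Set.Icc a b) := by
    refine antitoneOn_of_deriv_nonpos (convex_Icc a b)
      ((Continuous.continuousOn (by fun_prop)).mul hf)
      (fun t ht ↦ (hderiv_exp t ht).differentiableAt.differentiableWithinAt) fun t ht ↦ ?_
    rw [(hderiv_exp t ht).deriv]
    rw [interior_Icc] at ht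
    exact mul_nonpos_of_nonneg_of_nonpos (Real.exp_nonneg _) (sub_nonpos.2 (hle t ht))
  have hends := hanti (Set.left_mem_Icc.2 hab) (Set.right_mem_Icc.2 hab) hab
  calc f b = Real.exp (c * b) * (Real.exp (-(c * b)) * f b) := by
        rw [← mul_assoc, ← Real.exp_add, add_neg_cancel, Real.exp_zero, one_mul]
    _ ≤ Real.exp (c * b) * (Real.exp (-(c * a)) * f a) := by gcongr
    _ = Real.exp (c * (b - a)) * f a := by
        rw [← mul_assoc, ← Real.exp_add, ← sub_eq_add_neg, ← mul_sub]

end Integral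

section Path

lemma IsCutoff.exists_isCompact_forall_notMem_eq_zero {X : Type*} [TopologicalSpace X]
    {χ : ℝ → ℝ} {G u : X → ℝ} {c : ℝ} (hχ : IsCutoff χ) (hG : IsProperOnPos G) (hc : 0 ≤ c)
    (hu0 : ∀ x, 0 ≤ u x) (huG : ∀ x, u x ≤ c * G x) :
    ∃ C, IsCompact C ∧ ∀ t ∈ Set.Icc (0 : ℝ) 1, ∀ x ∉ C, χ (G x + t * u x) = 0 := by
  obtain ⟨C, hC, hCF⟩ := hG.exists_isCompact (L := 1 + c) hχ.hasCompactSupport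
    hχ.tsupport_subset (by linarith)
  refine ⟨C, hC, fun t ht x hx ↦ image_eq_zero_of_notMem_tsupport fun hmem ↦ hx ?_⟩
  refine hCF (fun x ↦ G x + t * u x) (fun x ↦ le_add_of_nonneg_right (mul_nonneg ht.1 (hu0 x)))
    (fun x ↦ ?_) hmem
  linarith [mul_le_of_le_one_left (hu0 x) ht.2, huG x]

section LogPairing

variable {E : Type*} [NormedAddCommGroup E] [NormedSpace ℝ E]
  {H : Type*} [TopologicalSpace H] {I : ModelWithCorners ℝ E H}
  {M : Type*} [TopologicalSpace M] [ChartedSpace H M] {V : Π p : M, TangentSpace I p}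
  {F G u : M → ℝ} {t : ℝ}

lemma IsPositiveLinear.add_const_mul (hG : IsPositiveLinear V G) (hu : HasSlope V 1 u)
    (hu0 : ∀ p, 0 ≤ u p) (ht : 0 ≤ t) : IsPositiveLinear V (fun p ↦ G p + t * u p) where
  smooth := hG.smooth.add (contMDiff_const.mul hu.smooth)
  linear p := by
    have htu : HasSlope V 1 (fun p ↦ t * u p) := by simpa using (hasSlope_zero_const t).mul hu
    rw [mvfderiv_fun_add hG.hasSlope.mdifferentiableAt htu.mdifferentiableAt, add_apply,
      hG.linear, htu.mvfderiv_apply, one_mul]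
  pos p := add_pos_of_pos_of_nonneg (hG.pos p) (mul_nonneg ht (hu0 p))

variable [FiniteDimensional ℝ E] [IsManifold I ∞ M] [I.Boundaryless] {g : SmoothMetric I M}
  {T : Set ℝ}

lemma HasPosSemidefHessian.segment (hGp : HasPosSemidefHessian g G)
    (hFp : HasPosSemidefHessian g F) (hG : ContMDiff I 𝓘(ℝ) ∞ G) (hF : ContMDiff I 𝓘(ℝ) ∞ F)
    (ht : t ∈ Set.Icc (0 : ℝ) 1) :
    HasPosSemidefHessian g (fun p ↦ G p + t * (F p - G p)) := by
  have hconvex : (fun p ↦ G p + t * (F p - G p)) = fun p ↦ (1 - t) * G p + t * F p :=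
    funext fun p ↦ by ring
  rw [hconvex]
  exact (hGp.const_mul (sub_nonneg.2 ht.2) hG).add (hFp.const_mul ht.1 hF)
    (contMDiff_const.mul hG) (contMDiff_const.mul hF)

variable (g)

lemma continuousOn_logPairing_add_const_mul_left (hG : ContMDiff I 𝓘(ℝ) ∞ G)
    (hu : ContMDiff I 𝓘(ℝ) ∞ u) (h0 : ∀ t ∈ T, ∀ p, G p + t * u p ≠ 0) :
    ContinuousOn (fun q : ℝ × M ↦ logPairing g (fun p ↦ G p + q.1 * u p) u q.2)
      (T ×ˢ Set.univ) := by
  simp only [logPairing_add_const_mul_left g (hG.mdifferentiableAt (by simp))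
    (hu.mdifferentiableAt (by simp))]
  have hGu := (contMDiff_pairing_grad g hG hu).continuous
  have huu := (contMDiff_pairing_grad g hu hu).continuous
  have hGc := hG.continuous
  have huc := hu.continuous
  exact ContinuousOn.div (by fun_prop) (by fun_prop) fun q hq ↦ h0 q.1 hq.1 q.2

lemma continuousOn_logPairing_add_const_mul_self (hG : ContMDiff I 𝓘(ℝ) ∞ G)
    (hu : ContMDiff I 𝓘(ℝ) ∞ u) (h0 : ∀ t ∈ T, ∀ p, G p + t * u p ≠ 0) :
    ContinuousOn (fun q : ℝ × M ↦
      logPairing g (fun p ↦ G p + q.1 * u p) (fun p ↦ G p + q.1 * u p) q.2)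
      (T ×ˢ Set.univ) := by
  simp only [logPairing_add_const_mul_self g (hG.mdifferentiableAt (by simp))
    (hu.mdifferentiableAt (by simp))]
  have hGG := (contMDiff_pairing_grad g hG hG).continuous
  have hGu := (contMDiff_pairing_grad g hG hu).continuous
  have huu := (contMDiff_pairing_grad g hu hu).continuous
  have hGc := hG.continuous
  have huc := hu.continuous
  exact ContinuousOn.div (by fun_prop) (by fun_prop) fun q hq ↦ h0 q.1 hq.1 q.2

lemma continuousOn_firstVariation {χ : ℝ → ℝ} (hχ : IsCutoff χ) (hG : ContMDiff I 𝓘(ℝ) ∞ G)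
    (hu : ContMDiff I 𝓘(ℝ) ∞ u) (h0 : ∀ t ∈ T, ∀ p, G p + t * u p ≠ 0) :
    ContinuousOn (fun q : ℝ × M ↦ firstVariation g χ (fun p ↦ G p + q.1 * u p) u q.2)
      (T ×ˢ Set.univ) := by
  have hself := continuousOn_logPairing_add_const_mul_self g hG hu h0
  have hleft := continuousOn_logPairing_add_const_mul_left g hG hu h0
  have hGc := hG.continuous
  have huc := hu.continuous
  have hχc := hχ.contDiff.continuous
  have hχ'c := hχ.deriv.contDiff.continuous
  have hratio : ContinuousOn (fun q : ℝ × M ↦ u q.2 / (G q.2 + q.1 * u q.2)) (T ×ˢ Set.univ) :=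
    ContinuousOn.div (by fun_prop) (by fun_prop) fun q hq ↦ h0 q.1 hq.1 q.2
  unfold firstVariation
  fun_prop

end LogPairing

section Comparison

variable {d : ℕ} {M : Type*} [TopologicalSpace M] [ChartedSpace (EuclideanSpace ℝ (Fin d)) M]
  [IsManifold (𝓡 d) ∞ M] [MeasurableSpace M] [BorelSpace M]
  {g : SmoothMetric (𝓡 d) M} {V : Π p : M, TangentSpace (𝓡 d) p} {F G u : M → ℝ} {χ : ℝ → ℝ}
  {c L t : ℝ}

lemma continuousOn_integral_cutoff_logPairing (hχ : IsCutoff χ) (hG : IsPositiveLinear V G)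
    (hGp : IsProperOnPos G) (hu : HasSlope V 1 u) (hc : 0 ≤ c) (hu0 : ∀ p, 0 ≤ u p)
    (huG : ∀ p, u p ≤ c * G p) :
    ContinuousOn (fun t ↦ ∫ p, χ (G p + t * u p) *
      logPairing g (fun q ↦ G q + t * u q) (fun q ↦ G q + t * u q) p ∂(riemannianVolume g))
      (Set.Icc 0 1) := by
  obtain ⟨C, hC, hC0⟩ := hχ.exists_isCompact_forall_notMem_eq_zero hGp hc hu0 huG
  have hself := continuousOn_logPairing_add_const_mul_self g (T := Set.Icc 0 1) hG.smooth hu.smooth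
    fun t ht p ↦ ((hG.add_const_mul hu hu0 ht.1).pos p).ne'
  have hχc := hχ.contDiff.continuous
  have hGc := hG.smooth.continuous
  have huc := hu.smooth.continuous
  refine continuousOn_integral_of_compact_support hC ?_ fun t p ht hp ↦ ?_
  · unfold Function.uncurry
    fun_prop
  · rw [hC0 t ht p hp, zero_mul]

variable [T2Space M]

lemma hasDerivAt_integral_cutoff_logPairing (hχ : IsCutoff χ) (hG : IsPositiveLinear V G)
    (hGp : IsProperOnPos G) (hu : HasSlope V 1 u) (hc : 0 ≤ c) (hu0 : ∀ p, 0 ≤ u p)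
    (huG : ∀ p, u p ≤ c * G p) (ht : t ∈ Set.Ioo (0 : ℝ) 1) :
    HasDerivAt (fun t ↦ ∫ p, χ (G p + t * u p) *
      logPairing g (fun q ↦ G q + t * u q) (fun q ↦ G q + t * u q) p ∂(riemannianVolume g))
      (∫ p, firstVariation g χ (fun q ↦ G q + t * u q) u p ∂(riemannianVolume g)) t := by
  obtain ⟨C, hC, hC0⟩ := hχ.exists_isCompact_forall_notMem_eq_zero hGp hc hu0 huG
  have h0 (t : ℝ) (ht : t ∈ Set.Ioo (0 : ℝ) 1) (p : M) : G p + t * u p ≠ 0 :=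
    ((hG.add_const_mul hu hu0 ht.1.le).pos p).ne'
  have hself := continuousOn_logPairing_add_const_mul_self g hG.smooth hu.smooth h0
  have hχc := hχ.contDiff.continuous
  have hGc := hG.smooth.continuous
  have huc := hu.smooth.continuous
  refine hasDerivAt_integral_of_compact_support
    (f' := fun t ↦ firstVariation g χ (fun q ↦ G q + t * u q) u) isOpen_Ioo ht hC (fun s hs ↦ ?_)
    (continuousOn_firstVariation g hχ hG.smooth hu.smooth h0) (fun s hs p ↦ ?_) fun s hs p hp ↦ ?_
  · have hslice := hself.comp_continuous (f := fun p ↦ (s, p)) (by fun_prop)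
      fun p ↦ ⟨hs, Set.mem_univ p⟩
    fun_prop
  · exact hasDerivAt_cutoff_mul_logPairing g hG.hasSlope.mdifferentiableAt hu.mdifferentiableAt
      (hχ.contDiff.differentiable (by simp)) (h0 s hs p)
  · rw [hC0 s (Set.Ioo_subset_Icc_self hs) p hp, zero_mul]

variable [SigmaCompactSpace M]

/-- Grönwall's inequality along the segment from `G` to `F`. -/
lemma IsEulerField.integral_cutoff_logPairing_le (hV : IsEulerField g V) (hχ : IsCutoff χ)
    (hχ0 : ∀ s, 0 ≤ χ s) (hG : IsPositiveLinear V G) (hF : IsPositiveLinear V F)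
    (hGpsd : HasPosSemidefHessian g G) (hFpsd : HasPosSemidefHessian g F)
    (hGp : IsProperOnPos G) (hL : 1 ≤ L) (hGF : ∀ p, G p ≤ F p) (hFG : ∀ p, F p ≤ L * G p) :
    ∫ p, χ (F p) * logPairing g F F p ∂(riemannianVolume g) ≤
      Real.exp ((L - 1) * (d : ℝ) ^ 2 / 2) *
        ∫ p, χ (G p) * logPairing g G G p ∂(riemannianVolume g) := by
  have hL0 : 0 ≤ L - 1 := sub_nonneg.2 hL
  have hu : HasSlope V 1 (fun p ↦ F p - G p) := hF.hasSlope.sub hG.hasSlope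
  have hu0 (p : M) : 0 ≤ F p - G p := sub_nonneg.2 (hGF p)
  have huG (p : M) : F p - G p ≤ (L - 1) * G p := by linarith [hFG p]
  have hgronwall := le_exp_mul_of_deriv_le_mul zero_le_one
    (continuousOn_integral_cutoff_logPairing (g := g) hχ hG hGp hu hL0 hu0 huG)
    (fun t ht ↦ hasDerivAt_integral_cutoff_logPairing (g := g) hχ hG hGp hu hL0 hu0 huG ht)
    (c := (L - 1) * (d : ℝ) ^ 2 / 2) fun t ht ↦ ?_
  · simpa using hgronwall
  · have hGFt (p : M) : G p ≤ G p + t * (F p - G p) :=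
      le_add_of_nonneg_right (mul_nonneg ht.1.le (hu0 p))
    have hFtG (p : M) : G p + t * (F p - G p) ≤ L * G p := by
      linarith [mul_le_of_le_one_left (hu0 p) ht.2.le, huG p]
    have hFt := hG.add_const_mul hu hu0 ht.1.le
    exact hV.integral_firstVariation_le hχ hχ0 hFt
      (hGp.of_le_of_le_mul hFt.smooth.continuous (by linarith) hGFt hFtG)
      (hGpsd.segment hFpsd hG.smooth hF.smooth (Set.Ioo_subset_Icc_self ht)) hu hu0
      fun p ↦ (huG p).trans (mul_le_mul_of_nonneg_left (hGFt p) hL0)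

lemma IsEulerField.integral_cutoff_laplacian_le (hV : IsEulerField g V) (hχ : IsCutoff χ)
    (hχ0 : ∀ s, 0 ≤ χ s) (hG : IsPositiveLinear V G) (hF : IsPositiveLinear V F)
    (hGpsd : HasPosSemidefHessian g G) (hFpsd : HasPosSemidefHessian g F)
    (hGp : IsProperOnPos G) (hL : 1 ≤ L) (hGF : ∀ p, G p ≤ F p) (hFG : ∀ p, F p ≤ L * G p) :
    ∫ p, χ (F p) * laplacian g F p ∂(riemannianVolume g) ≤
      Real.exp ((L - 1) * (d : ℝ) ^ 2 / 2) *
        ∫ p, χ (G p) * laplacian g G p ∂(riemannianVolume g) := by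
  have hFp := hGp.of_le_of_le_mul hF.smooth.continuous (by linarith) hGF hFG
  rw [hV.integral_cutoff_laplacian hχ hF hFp, hV.integral_cutoff_laplacian hχ hG hGp,
    mul_left_comm]
  exact mul_le_mul_of_nonneg_left
    (hV.integral_cutoff_logPairing_le hχ hχ0 hG hF hGpsd hFpsd hGp hL hGF hFG) (by positivity)

end Comparison

end Path

section CutoffFamily

/-- A smooth increasing function equal to `0` for `s ≤ 1 / a` and to `1` for `2 / a ≤ s`;
it keeps integrals away from the vertex `F = 0`. -/
noncomputable def lowerCutoff (a s : ℝ) : ℝ := Real.smoothTransition (a * s - 1)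

/-- A smooth decreasing function equal to `1` for `s ≤ 1` and to `0` for `1 + 1 / b ≤ s`;
it approximates the indicator of `s ≤ 1` as `b` grows. -/
noncomputable def upperCutoff (b s : ℝ) : ℝ := Real.smoothTransition (1 + b * (1 - s))

variable {χ : ℝ → ℝ} {a b s : ℝ}

lemma contDiff_lowerCutoff : ContDiff ℝ ∞ (lowerCutoff a) :=
  Real.smoothTransition.contDiff.comp (by fun_prop)

lemma contDiff_upperCutoff : ContDiff ℝ ∞ (upperCutoff b) :=
  Real.smoothTransition.contDiff.comp (by fun_prop)

lemma lowerCutoff_nonneg : 0 ≤ lowerCutoff a s := Real.smoothTransition.nonneg _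

lemma upperCutoff_nonneg : 0 ≤ upperCutoff b s := Real.smoothTransition.nonneg _

lemma lowerCutoff_le_one : lowerCutoff a s ≤ 1 := Real.smoothTransition.le_one _

lemma lowerCutoff_eq_zero (hs : a * s ≤ 1) : lowerCutoff a s = 0 :=
  Real.smoothTransition.zero_of_nonpos (by linarith)

lemma lowerCutoff_eq_one (hs : 2 ≤ a * s) : lowerCutoff a s = 1 :=
  Real.smoothTransition.one_of_one_le (by linarith)

lemma upperCutoff_eq_one (hb : 0 ≤ b) (hs : s ≤ 1) : upperCutoff b s = 1 :=
  Real.smoothTransition.one_of_one_le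
    (le_add_of_nonneg_right (mul_nonneg hb (sub_nonneg.2 hs)))

lemma upperCutoff_eq_zero (hs : 1 ≤ b * (s - 1)) : upperCutoff b s = 0 :=
  Real.smoothTransition.zero_of_nonpos (by linarith)

lemma monotone_lowerCutoff (ha : 0 ≤ a) : Monotone (lowerCutoff a) := fun _ _ hst ↦
  Real.smoothTransition.monotone (by gcongr)

lemma antitone_upperCutoff (hb : 0 ≤ b) : Antitone (upperCutoff b) := fun _ _ hst ↦
  Real.smoothTransition.monotone (by gcongr)

lemma upperCutoff_le_upperCutoff {c : ℝ} (hb : 0 ≤ b) (hbc : b ≤ c) :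
    upperCutoff c s ≤ upperCutoff b s := by
  obtain hs | hs := le_total s 1
  · rw [upperCutoff_eq_one hb hs, upperCutoff_eq_one (hb.trans hbc) hs]
  · exact Real.smoothTransition.monotone (by nlinarith)

lemma isCutoff_of_eq_zero_off_Icc (hχ : ContDiff ℝ ∞ χ) (ha : 0 < a)
    (hχ0 : ∀ s ∉ Set.Icc a b, χ s = 0) : IsCutoff χ where
  contDiff := hχ
  hasCompactSupport := .intro isCompact_Icc hχ0
  tsupport_subset := (closure_minimal (fun s hs ↦ not_imp_comm.1 (hχ0 s) hs) isClosed_Icc).trans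
    fun _ hs ↦ ha.trans_le hs.1

lemma isCutoff_lowerCutoff_mul_upperCutoff (ha : 0 < a) (hb : 0 < b) :
    IsCutoff (fun s ↦ lowerCutoff a s * upperCutoff b s) := by
  refine isCutoff_of_eq_zero_off_Icc (contDiff_lowerCutoff.mul contDiff_upperCutoff)
    (one_div_pos.2 ha) (b := 1 + 1 / b) fun s hs ↦ ?_
  obtain hs | hs := not_and_or.1 hs
  · rw [lowerCutoff_eq_zero ((le_div_iff₀' ha).1 (not_le.1 hs).le), zero_mul]
  · rw [upperCutoff_eq_zero ((div_le_iff₀' hb).1 (by linarith)), mul_zero]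

lemma isCutoff_deriv_upperCutoff (hb : 0 < b) : IsCutoff (deriv (upperCutoff b)) := by
  refine isCutoff_of_eq_zero_off_Icc (contDiff_infty_iff_deriv.1 contDiff_upperCutoff).2 one_pos
    (b := 1 + 1 / b) fun s hs ↦ ?_
  obtain hs | hs := not_and_or.1 hs
  · have heq : upperCutoff b =ᶠ[nhds s] fun _ ↦ 1 := by
      filter_upwards [gt_mem_nhds (not_le.1 hs)] with r hr
      exact upperCutoff_eq_one hb.le hr.le
    rw [heq.deriv_eq, deriv_const]
  · have heq : upperCutoff b =ᶠ[nhds s] fun _ ↦ 0 := by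
      filter_upwards [lt_mem_nhds (not_le.1 hs)] with r hr
      exact upperCutoff_eq_zero ((div_le_iff₀' hb).1 (by linarith))
    rw [heq.deriv_eq, deriv_const]

lemma neg_deriv_lowerCutoff_mul_upperCutoff_le (ha : 0 ≤ a) (hb : 0 ≤ b) :
    -deriv (fun s ↦ lowerCutoff a s * upperCutoff b s) s ≤ -deriv (upperCutoff b) s := by
  rw [deriv_fun_mul (contDiff_lowerCutoff.differentiable (by simp) s)
    (contDiff_upperCutoff.differentiable (by simp) s)]
  have hlower : 0 ≤ deriv (lowerCutoff a) s * upperCutoff b s :=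
    mul_nonneg (monotone_lowerCutoff ha).deriv_nonneg upperCutoff_nonneg
  have hupper : lowerCutoff a s * -deriv (upperCutoff b) s ≤ -deriv (upperCutoff b) s :=
    mul_le_of_le_one_left (neg_nonneg.2 (antitone_upperCutoff hb).deriv_nonpos) lowerCutoff_le_one
  linarith

lemma tendsto_natCast_add_one_mul_atTop (hs : 0 < s) :
    Filter.Tendsto (fun n : ℕ ↦ ((n : ℝ) + 1) * s) Filter.atTop Filter.atTop :=
  (Filter.tendsto_atTop_add_const_right _ 1 tendsto_natCast_atTop_atTop).atTop_mul_const hs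

lemma tendsto_lowerCutoff_mul_upperCutoff (hs : 0 < s) :
    Filter.Tendsto (fun n : ℕ ↦ lowerCutoff (n + 1) s * upperCutoff (n + 1) s) Filter.atTop
      (nhds (if s ≤ 1 then 1 else 0)) := by
  refine tendsto_const_nhds.congr' ?_
  split_ifs with hs1
  · filter_upwards [(tendsto_natCast_add_one_mul_atTop hs).eventually_ge_atTop 2] with n hn
    rw [lowerCutoff_eq_one hn, upperCutoff_eq_one (by positivity) hs1, one_mul]
  · filter_upwards [(tendsto_natCast_add_one_mul_atTop
      (sub_pos.2 (not_le.1 hs1))).eventually_ge_atTop 1] with n hn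
    rw [upperCutoff_eq_zero hn, mul_zero]

end CutoffFamily

section Limit

variable {d : ℕ} {M : Type*} [TopologicalSpace M] [ChartedSpace (EuclideanSpace ℝ (Fin d)) M]
  [IsManifold (𝓡 d) ∞ M] [T2Space M] [SigmaCompactSpace M] [MeasurableSpace M] [BorelSpace M]
  {g : SmoothMetric (𝓡 d) M} {V : Π p : M, TangentSpace (𝓡 d) p} {F : M → ℝ} {a b : ℝ}

/-- The bound does not depend on `a`, because the lower cutoff contributes to
`-∫ χ'(F) |∇F|²` with a favourable sign. -/
lemma IsEulerField.integral_lowerCutoff_mul_upperCutoff_le (hV : IsEulerField g V)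
    (hF : IsPositiveLinear V F) (hFp : IsProperOnPos F) (ha : 0 < a) (hb : 0 < b) :
    ∫ p, lowerCutoff a (F p) * upperCutoff b (F p) * laplacian g F p ∂(riemannianVolume g) ≤
      ∫ p, -(deriv (upperCutoff b) (F p) * (F p * logPairing g F F p)) ∂(riemannianVolume g) := by
  have hχ := isCutoff_lowerCutoff_mul_upperCutoff ha hb
  have hP : HasSlope V 0 (logPairing g F F) := by
    simpa using hF.hasSlope.logPairing hV (fun p ↦ (hF.pos p).ne') hF.hasSlope
  have hFP := hF.smooth.continuous.mul hP.smooth.continuous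
  have hparts : ∫ p, lowerCutoff a (F p) * upperCutoff b (F p) * laplacian g F p
        ∂(riemannianVolume g) =
      ∫ p, -(deriv (fun s ↦ lowerCutoff a s * upperCutoff b s) (F p) *
        (F p * logPairing g F F p)) ∂(riemannianVolume g) := by
    rw [hV.integral_cutoff_laplacian hχ hF hFp, integral_neg,
      hV.integral_deriv_cutoff_mul hχ hF.hasSlope hFp hP, neg_mul, neg_neg]
  rw [hparts]
  refine integral_mono (hχ.deriv.integrable hFp hF.smooth.continuous hFP).neg
    ((isCutoff_deriv_upperCutoff hb).integrable hFp hF.smooth.continuous hFP).neg fun p ↦ ?_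
  have hweight : 0 ≤ F p * logPairing g F F p :=
    mul_nonneg (hF.pos p).le (logPairing_self_nonneg (hF.pos p).le)
  simpa only [neg_mul] using mul_le_mul_of_nonneg_right
    (neg_deriv_lowerCutoff_mul_upperCutoff_le (s := F p) ha.le hb.le) hweight

lemma IsEulerField.integrable_upperCutoff_mul_laplacian (hV : IsEulerField g V)
    (hF : IsPositiveLinear V F) (hFp : IsProperOnPos F) (hpsd : HasPosSemidefHessian g F)
    (hb : 0 < b) :
    Integrable (fun p ↦ upperCutoff b (F p) * laplacian g F p) (riemannianVolume g) := by
  have hFc := hF.smooth.continuous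
  have hcover : AECover (riemannianVolume g) Filter.atTop
      fun n : ℕ ↦ {p | 2 ≤ ((n : ℝ) + 1) * F p} :=
    ⟨.of_forall fun p ↦ (tendsto_natCast_add_one_mul_atTop (hF.pos p)).eventually_ge_atTop 2,
      fun _ ↦ (isClosed_le continuous_const (by fun_prop)).measurableSet⟩
  have heq (n : ℕ) : Set.EqOn
      (fun p ↦ lowerCutoff (n + 1) (F p) * upperCutoff b (F p) * laplacian g F p)
      (fun p ↦ upperCutoff b (F p) * laplacian g F p) {p | 2 ≤ ((n : ℝ) + 1) * F p} :=
    fun p hp ↦ by simp only [lowerCutoff_eq_one hp, one_mul]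
  have hint (n : ℕ) : Integrable
      (fun p ↦ lowerCutoff (n + 1) (F p) * upperCutoff b (F p) * laplacian g F p)
      (riemannianVolume g) :=
    (isCutoff_lowerCutoff_mul_upperCutoff n.cast_add_one_pos hb).integrable hFp hFc
      (continuous_laplacian hF.smooth)
  refine hcover.integrable_of_integral_norm_bounded _
    (fun n ↦ (hint n).integrableOn.congr_fun (heq n) (hcover.measurableSet n))
    (.of_forall fun n ↦ le_trans ?_
      (hV.integral_lowerCutoff_mul_upperCutoff_le hF hFp n.cast_add_one_pos hb))
  rw [← setIntegral_congr_fun (hcover.measurableSet n) fun p hp ↦ congrArg norm (heq n hp)]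
  refine (setIntegral_le_integral (hint n).norm (.of_forall fun _ ↦ norm_nonneg _)).trans_eq ?_
  exact integral_congr_ae <| .of_forall fun p ↦ Real.norm_of_nonneg <|
    mul_nonneg (mul_nonneg lowerCutoff_nonneg upperCutoff_nonneg)
      (laplacian_nonneg hF.smooth hpsd p)

lemma IsEulerField.integrableOn_laplacian (hV : IsEulerField g V) (hF : IsPositiveLinear V F)
    (hFp : IsProperOnPos F) (hpsd : HasPosSemidefHessian g F) :
    IntegrableOn (laplacian g F) {p | F p ≤ 1} (riemannianVolume g) :=
  (hV.integrable_upperCutoff_mul_laplacian hF hFp hpsd one_pos).integrableOn.congr_fun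
    (fun p hp ↦ by simp only [upperCutoff_eq_one (s := F p) zero_le_one hp, one_mul])
    (isClosed_le hF.smooth.continuous continuous_const).measurableSet

lemma IsEulerField.tendsto_integral_cutoff_mul_laplacian (hV : IsEulerField g V)
    (hF : IsPositiveLinear V F) (hFp : IsProperOnPos F) (hpsd : HasPosSemidefHessian g F) :
    Filter.Tendsto (fun n : ℕ ↦ ∫ p, lowerCutoff (n + 1) (F p) * upperCutoff (n + 1) (F p) *
      laplacian g F p ∂(riemannianVolume g)) Filter.atTop (nhds (laplacianFunctional g F)) := by
  have hFc := hF.smooth.continuous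
  have hΔ := laplacian_nonneg hF.smooth hpsd
  rw [laplacianFunctional, ← integral_indicator (isClosed_le hFc continuous_const).measurableSet]
  refine tendsto_integral_of_dominated_convergence _ (fun n ↦ ?_)
    (hV.integrable_upperCutoff_mul_laplacian hF hFp hpsd one_pos) (fun n ↦ .of_forall fun p ↦ ?_)
    (.of_forall fun p ↦ ?_)
  · exact ((isCutoff_lowerCutoff_mul_upperCutoff n.cast_add_one_pos n.cast_add_one_pos).integrable
      hFp hFc (continuous_laplacian hF.smooth)).aestronglyMeasurable
  · rw [Real.norm_of_nonneg (mul_nonneg (mul_nonneg lowerCutoff_nonneg upperCutoff_nonneg) (hΔ p))]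
    refine mul_le_mul_of_nonneg_right ?_ (hΔ p)
    exact (mul_le_of_le_one_left upperCutoff_nonneg lowerCutoff_le_one).trans
      (upperCutoff_le_upperCutoff zero_le_one (le_add_of_nonneg_left n.cast_nonneg))
  · rw [Set.indicator_apply, ← boole_mul]
    exact (tendsto_lowerCutoff_mul_upperCutoff (hF.pos p)).mul_const _

omit [T2Space M] [SigmaCompactSpace M] [BorelSpace M] in
lemma laplacianFunctional_nonneg (hF : ContMDiff (𝓡 d) 𝓘(ℝ) ∞ F)
    (hpsd : HasPosSemidefHessian g F) : 0 ≤ laplacianFunctional g F :=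
  integral_nonneg (laplacian_nonneg hF hpsd)

end Limit

end LaplacianFunctional

open LaplacianFunctional MeasureTheory in
theorem mainTheorem7_general {d : ℕ}
    {M : Type*} [TopologicalSpace M] [T2Space M] [SigmaCompactSpace M]
    [ChartedSpace (EuclideanSpace ℝ (Fin d)) M] [IsManifold (𝓡 d) ∞ M]
    [MeasurableSpace M] [BorelSpace M] {g : SmoothMetric (𝓡 d) M}
    {V : Π p : M, TangentSpace (𝓡 d) p} (hV : IsEulerField g V) {G H : M → ℝ}
    (hG : IsPositiveLinear V G) (hH : IsPositiveLinear V H)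
    (hGpsd : HasPosSemidefHessian g G) (hHpsd : HasPosSemidefHessian g H)
    (hGp : IsProperOnPos G) {L : ℝ} (hL : 1 ≤ L)
    (hGH : ∀ p, G p ≤ H p) (hHG : ∀ p, H p ≤ L * G p) :
    IntegrableOn (laplacian g G) {p | G p ≤ 1} (riemannianVolume g) ∧
      IntegrableOn (laplacian g H) {p | H p ≤ 1} (riemannianVolume g) ∧
      laplacianFunctional g H ≤
        Real.exp ((L - 1) * (d : ℝ) ^ 2 / 2) * laplacianFunctional g G := by
  have hHp := hGp.of_le_of_le_mul hH.smooth.continuous (by linarith) hGH hHG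
  refine ⟨hV.integrableOn_laplacian hG hGp hGpsd, hV.integrableOn_laplacian hH hHp hHpsd, ?_⟩
  refine le_of_tendsto_of_tendsto' (hV.tendsto_integral_cutoff_mul_laplacian hH hHp hHpsd)
    ((hV.tendsto_integral_cutoff_mul_laplacian hG hGp hGpsd).const_mul _) fun n ↦ ?_
  exact hV.integral_cutoff_laplacian_le
    (isCutoff_lowerCutoff_mul_upperCutoff n.cast_add_one_pos n.cast_add_one_pos)
    (fun _ ↦ mul_nonneg lowerCutoff_nonneg upperCutoff_nonneg) hG hH hGpsd hHpsd hGp hL hGH hHG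

theorem mainTheorem7 {d m : ℕ}
    {M : Type*} [TopologicalSpace M] [T2Space M] [SecondCountableTopology M]
    [ChartedSpace (EuclideanSpace ℝ (Fin d)) M] [IsManifold (𝓡 d) ∞ M]
    [MeasurableSpace M] [BorelSpace M]
    {Y : Type*} [TopologicalSpace Y] [CompactSpace Y]
    [ChartedSpace (EuclideanSpace ℝ (Fin m)) Y] [IsManifold (𝓡 m) ∞ Y]
    (g : LaplacianFunctional.SmoothMetric (𝓡 d) M)
    (V : Π x : M, TangentSpace (𝓡 d) x)
    (hV : ContMDiff (𝓡 d) (𝓡 d).tangent ∞ (fun x ↦ (⟨x, V x⟩ : TangentBundle (𝓡 d) M)))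
    (ι : Y → M) (hcyl : LaplacianFunctional.IsCylindrical m V ι)
    (hg : LaplacianFunctional.IsLinearMetric g V 1)
    (hsa : LaplacianFunctional.IsSelfAdjointFor g (LaplacianFunctional.leviCivita g V))
    (G H : M → ℝ)
    (hG : LaplacianFunctional.IsPositiveLinear V G)
    (hH : LaplacianFunctional.IsPositiveLinear V H)
    (hGpsd : LaplacianFunctional.HasPosSemidefHessian g G)
    (hHpsd : LaplacianFunctional.HasPosSemidefHessian g H)
    (L : ℝ) (hL : 1 ≤ L) (hGH : ∀ p, G p ≤ H p) (hHG : ∀ p, H p ≤ L * G p) :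
    MeasureTheory.IntegrableOn (LaplacianFunctional.laplacian g G) {p | G p ≤ 1}
        (LaplacianFunctional.riemannianVolume g) ∧
      MeasureTheory.IntegrableOn (LaplacianFunctional.laplacian g H) {p | H p ≤ 1}
        (LaplacianFunctional.riemannianVolume g) ∧
      LaplacianFunctional.laplacianFunctional g H ≤
        Real.exp (L * (d : ℝ) ^ 2 / 2) * LaplacianFunctional.laplacianFunctional g G := by
  have : LocallyCompactSpace M := Manifold.locallyCompact_of_finiteDimensional (𝓡 d)
  obtain ⟨hGint, hHint, hle⟩ := mainTheorem7_general (hg.isEulerField hV hsa) hG hH hGpsd hHpsd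
    (hcyl.isProperOnPos hG) hL hGH hHG
  refine ⟨hGint, hHint, hle.trans (mul_le_mul_of_nonneg_right ?_
    (LaplacianFunctional.laplacianFunctional_nonneg hG.smooth hGpsd))⟩
  gcongr
  linarith
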